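/- Let $k$ be a field, $G$ a finite simple graph with vertex set $\{x_1,\dots,x_n\}$ and edges $e_1,\dots,e_r$, $R=k[x_1,\dots,x_n]$, let $f_i$ be the product of the two endpoints of $e_i$, and let $I=I(G)=(f_1,\dots,f_r)$ be the edge ideal. Let $J$ be the kernel of the $R$-algebra map $R[T_1,\dots,T_r]\to R[It]$, $T_i\mapsto f_it$. Let $\phi$ be the Taylor presentation matrix of $I$: its columns are indexed by the pairs $j<l$, and the column $\{j,l\}$ has the entry $-\operatorname{lcm}(f_j,f_l)/f_j$ in row $j$, the entry $\operatorname{lcm}(f_j,f_l)/f_l$ in row $l$, and zeros elsewhere. Let $B(\phi)$ be any Jacobian dual of $\phi$, i.e. a matrix whose entries are linear forms in $T_1,\dots,T_r$ over $R$ with $[T_1\cdots T_r]\,\phi=[x_1\cdots x_n]\,B(\phi)$, and let $\overline{B(\phi)}$, a matrix over $k[T_1,\dots,T_r]$, be its reduction modulo $(x_1,\dots,x_n)$. For an even closed walk $W$ of length $2t$ whose successive edges have the variables $T_{i_1},\dots,T_{i_{2t}}$, put $f_W=\prod_{s=1}^tT_{i_{2s}}-\prod_{s=1}^tT_{i_{2s-1}}$.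 Call $W$ primitive if $2t>2$ and $W$ has no closed subwalk (consisting of consecutive steps of $W$) of even length strictly between $0$ and $2t$. Call $W$ strongly primitive if $2t>2$ and there is no even closed walk in $G$, of length strictly between $0$ and $2t$, whose first, third, ... edges are, with multiplicity, among the first, third, ... edges of $W$ and whose second, fourth, ... edges are, with multiplicity, among the second, fourth, ... edges of $W$. Say that $f_W$ is a cyclic minor if $f_W=\det M$ for a $t\times t$ submatrix $M$ of $\overline{B(\phi)}$ (rows and columns taken in any order) which, after rearranging its rows and columns and changing the signs of some columns, becomes $$\begin{bmatrix}T_{i_2}&0&\cdots&-T_{i_{2t-1}}\\-T_{i_1}&T_{i_4}&\cdots&0\\0&-T_{i_3}&\cdots&0\\\vdots&\vdots&&\vdots\\0&0&\cdots&T_{i_{2t}}\end{bmatrix}.$$ A binomial is a sum or a difference of two distinct monomials (with coefficient $1$) in the variables $x_i,T_j$. Then the following hold. 1. Let $S$ be a minimal (irredundant) system of generators of $J$ consisting of binomials. Every $f\in S$ that is not linear (homogeneous of degree one) in $T_1,\dots,T_r$ equals $f_W$ for some even closed walk $W$ in $G$ that is both primitive and strongly primitive and for which $f_W$ is a cyclic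 minor. In particular, $f$ is a binomial minor of $\overline{B(\phi)}$. 2. $J$ is generated by the entries of $[T_1\cdots T_r]\,\phi$ together with the binomials $f_W$ of the strongly primitive even closed walks $W$ in $G$. 3. For every primitive even closed walk $W$ in $G$, $f_W$ is a cyclic minor. 4. Every strongly primitive even closed walk $W$ is primitive, and $f_W$ is then a binomial (in particular nonzero). -/

import Mathlib

open MvPolynomial

namespace EdgeRees

noncomputable section

variable {V : Type*} [Fintype V] {G : SimpleGraph V} {r : ℕ}

/-- The exponent vector of the monomial `x_u x_v` of an unordered pair `{u, v}`. -/
def edgeExp : Sym2 V → (V →₀ ℕ) :=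
  Sym2.lift ⟨fun u v => Finsupp.single u 1 + Finsupp.single v 1, fun _ _ => add_comm _ _⟩

/-- The exponent vector of `f_i`, for an enumeration `e` of the edges of `G`. -/
def genExp (e : Fin r ≃ G.edgeSet) (i : Fin r) : V →₀ ℕ := edgeExp (e i : Sym2 V)

/-- The generator `f_i = x_u x_v` of the edge ideal, where `{u, v}` is the `i`-th edge. -/
def edgeGen (k : Type*) [Field k] (e : Fin r ≃ G.edgeSet) (i : Fin r) : MvPolynomial V k :=
  monomial (genExp e i) 1

/-- The edge ideal `I(G) = (f_1, …, f_r)` in `R = k[x_v : v ∈ V]`. -/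
def edgeIdeal (k : Type*) [Field k] (e : Fin r ≃ G.edgeSet) : Ideal (MvPolynomial V k) :=
  Ideal.span (Set.range (edgeGen k e))

/-- The presentation `θ : R[T_1, …, T_r] → R[It]`, `T_i ↦ f_i t`, of the Rees algebra. -/
def reesPresentation (k : Type*) [Field k] (e : Fin r ≃ G.edgeSet) :
    MvPolynomial (Fin r) (MvPolynomial V k) →ₐ[MvPolynomial V k] reesAlgebra (edgeIdeal k e) :=
  aeval fun i => ⟨Polynomial.monomial 1 (edgeGen k e i),
    reesAlgebra.monomial_mem.mpr (by
      rw [pow_one]; exact Ideal.subset_span (Set.mem_range_self i))⟩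

/-- The defining ideal `J = ker θ` of the Rees algebra. -/
def definingIdeal (k : Type*) [Field k] (e : Fin r ≃ G.edgeSet) :
    Ideal (MvPolynomial (Fin r) (MvPolynomial V k)) :=
  RingHom.ker (reesPresentation k e)

/-- The columns of the Taylor presentation matrix: two-element subsets `{j < l}` of the index set
of the generators. -/
abbrev TaylorCol (r : ℕ) : Type := {p : Fin r × Fin r // p.1 < p.2}

/-- The Taylor presentation matrix. In the column `{j < l}` the entry in row `j` is
`-lcm(f_j, f_l) / f_j`, the entry in row `l` is `lcm(f_j, f_l) / f_l`, all others are `0`.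
The least common multiple of monomials is the supremum of their exponents. -/
def taylorMatrix (k : Type*) [Field k] (e : Fin r ≃ G.edgeSet) :
    Matrix (Fin r) (TaylorCol r) (MvPolynomial V k) := fun i c =>
  if i = c.1.1 then
    -monomial ((genExp e c.1.1 ⊔ genExp e c.1.2) - genExp e c.1.1) 1
  else if i = c.1.2 then
    monomial ((genExp e c.1.1 ⊔ genExp e c.1.2) - genExp e c.1.2) 1
  else 0

/-- The row vector `[T_1 … T_r] · φ`. -/
def linearEquations {k : Type*} [Field k] {C : Type*}
    (φ : Matrix (Fin r) C (MvPolynomial V k)) : C → MvPolynomial (Fin r) (MvPolynomial V k) :=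
  Matrix.vecMul (fun i => X i) (φ.map MvPolynomial.C)

/-- `B` is a Jacobian dual of `φ`: its entries are linear forms in `T_1, …, T_r` over `R`, and
`[T_1 … T_r] · φ = [x_1 … x_n] · B`. -/
def IsJacobianDual {k : Type*} [Field k] {C : Type*} (φ : Matrix (Fin r) C (MvPolynomial V k))
    (B : Matrix V C (MvPolynomial (Fin r) (MvPolynomial V k))) : Prop :=
  (∀ v c, (B v c).IsHomogeneous 1) ∧
    linearEquations φ = Matrix.vecMul (fun v => MvPolynomial.C (X v)) B

/-- A Jacobian dual of the Taylor presentation matrix exists. -/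
theorem exists_isJacobianDual (k : Type*) [Field k] (e : Fin r ≃ G.edgeSet) :
    ∃ B : Matrix V (TaylorCol r) (MvPolynomial (Fin r) (MvPolynomial V k)),
      IsJacobianDual (taylorMatrix k e) B := by
  have hsum : ∀ s : Sym2 V, (edgeExp s).sum (fun _ n => n) = 2 := by
    intro s
    induction s with | _ u v =>
    simp only [edgeExp, Sym2.lift_mk]
    rw [Finsupp.sum_add_index'] <;> simp
  have hinj : ∀ s s' : Sym2 V, edgeExp s ≤ edgeExp s' → edgeExp s = edgeExp s' := by
    intro s s' h
    have h1 := hsum s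
    have h2 := hsum s'
    have h3 : edgeExp s' = edgeExp s + (edgeExp s' - edgeExp s) := (add_tsub_cancel_of_le h).symm
    rw [h3, Finsupp.sum_add_index' (by simp) (by simp), h1] at h2
    have h4 : (edgeExp s' - edgeExp s).sum (fun _ n => n) = 0 := by omega
    have h5 : edgeExp s' - edgeExp s = 0 := by
      ext v
      by_contra hv
      have := Finset.sum_eq_zero_iff.mp h4 v (Finsupp.mem_support_iff.mpr hv)
      exact hv this
    rw [h3, h5, add_zero]
  have hexp : ∀ s s' : Sym2 V, edgeExp s = edgeExp s' → s = s' := by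
    classical
    intro s s' h
    induction s with | _ a b =>
    induction s' with | _ c d =>
    simp only [edgeExp, Sym2.lift_mk] at h
    have ha := DFunLike.congr_fun h a
    have hb := DFunLike.congr_fun h b
    have hc := DFunLike.congr_fun h c
    have hd := DFunLike.congr_fun h d
    simp only [Finsupp.add_apply, Finsupp.single_apply] at ha hb hc hd
    rw [Sym2.eq_iff]
    grind
  have hgen : ∀ i j : Fin r, i ≠ j → ¬ genExp e j ≤ genExp e i := by
    intro i j hij hle
    exact hij (e.injective (Subtype.ext (hexp _ _ (hinj _ _ hle)))).symm
  have hmem : ∀ i c, taylorMatrix k e i c ∈ Ideal.span (Set.range (X : V → MvPolynomial V k)) := by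
    have key : ∀ m : V →₀ ℕ, m ≠ 0 →
        (monomial m (1 : k)) ∈ Ideal.span (Set.range (X : V → MvPolynomial V k)) := by
      intro m hm
      obtain ⟨v, hv⟩ := Finsupp.ne_iff.mp hm
      exact Ideal.mem_of_dvd _ (X_dvd_monomial.mpr (Or.inr hv))
        (Ideal.subset_span (Set.mem_range_self v))
    intro i c
    have hc : c.1.1 ≠ c.1.2 := c.2.ne
    unfold taylorMatrix
    split_ifs
    · refine neg_mem (key _ fun h => hgen _ _ hc ?_)
      exact le_sup_right.trans (tsub_eq_zero_iff_le.mp h)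
    · refine key _ fun h => hgen _ _ hc.symm ?_
      exact le_sup_left.trans (tsub_eq_zero_iff_le.mp h)
    · exact zero_mem _
  have hq : ∀ i c, ∃ q : V → MvPolynomial V k, ∑ v, q v * X v = taylorMatrix k e i c := fun i c =>
    Ideal.mem_span_range_iff_exists_fun.mp (hmem i c)
  choose q hq using hq
  refine ⟨fun v c => ∑ i, X i * C (q i c v), fun v c => ?_, ?_⟩
  · refine IsHomogeneous.sum _ _ _ fun i _ => ?_
    simpa using (isHomogeneous_X _ i).mul (isHomogeneous_C (Fin r) (q i c v))
  · funext c
    simp only [linearEquations, Matrix.vecMul, dotProduct, Matrix.map_apply, Finset.mul_sum]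
    rw [Finset.sum_comm]
    refine Finset.sum_congr rfl fun i _ => ?_
    rw [← hq i c, map_sum, Finset.mul_sum]
    refine Finset.sum_congr rfl fun v _ => ?_
    rw [C_mul]
    ring

/-- The reduction of `B` modulo `𝔪 = (x_1, …, x_n)`, with entries in `(R/𝔪)[T] = k[T]`. -/
def reduced {k : Type*} [Field k] {C : Type*}
    (B : Matrix V C (MvPolynomial (Fin r) (MvPolynomial V k))) :
    Matrix V C (MvPolynomial (Fin r) k) :=
  B.map (MvPolynomial.map constantCoeff)

/-- The inclusion `k[T] → R[T]`. -/
def incl (V : Type*) (k : Type*) [Field k] (r : ℕ) :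
    MvPolynomial (Fin r) k →+* MvPolynomial (Fin r) (MvPolynomial V k) :=
  MvPolynomial.map (MvPolynomial.C)

/-- A binomial of `R[T]`: a sum or a difference of two distinct monomials `x^a T^α`. -/
def IsBinomial {k : Type*} [Field k] (f : MvPolynomial (Fin r) (MvPolynomial V k)) : Prop :=
  ∃ (α β : Fin r →₀ ℕ) (a b : V →₀ ℕ), (α, a) ≠ (β, b) ∧
    (f = monomial α (monomial a 1) - monomial β (monomial b 1) ∨
      f = monomial α (monomial a 1) + monomial β (monomial b 1))

/-- `S` is a minimal system of binomial generators of the ideal `J`. -/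
def IsMinimalBinomialSystem {k : Type*} [Field k]
    (J : Ideal (MvPolynomial (Fin r) (MvPolynomial V k)))
    (S : Set (MvPolynomial (Fin r) (MvPolynomial V k))) : Prop :=
  (∀ g ∈ S, IsBinomial g) ∧ Ideal.span S = J ∧ ∀ g ∈ S, g ∉ Ideal.span (S \ {g})

/-- The index of the edge traversed by the walk `W` in step `i` (steps are counted from `0`). -/
def edgeIdx (e : Fin r ≃ G.edgeSet) {v w : V} (W : G.Walk v w) (i : Fin W.length) : Fin r :=
  e.symm ⟨s(W.getVert i, W.getVert (i + 1)), W.adj_getVert_succ i.2⟩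

/-- The exponent of the product of the variables of the first, third, fifth, … edge of `W`. -/
def oddExp (e : Fin r ≃ G.edgeSet) {v w : V} (W : G.Walk v w) : Fin r →₀ ℕ :=
  ∑ i ∈ Finset.univ.filter (fun i : Fin W.length => Even i.val), Finsupp.single (edgeIdx e W i) 1

/-- The exponent of the product of the variables of the second, fourth, sixth, … edge of `W`. -/
def evenExp (e : Fin r ≃ G.edgeSet) {v w : V} (W : G.Walk v w) : Fin r →₀ ℕ :=
  ∑ i ∈ Finset.univ.filter (fun i : Fin W.length => Odd i.val), Finsupp.single (edgeIdx e W i) 1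

/-- The binomial `∏ T_{2i} - ∏ T_{2i-1}` of a walk with edges `T_1, …, T_{2t}` in this order. -/
def walkBinomial (k : Type*) [Field k] (e : Fin r ≃ G.edgeSet) {v w : V} (W : G.Walk v w) :
    MvPolynomial (Fin r) k :=
  monomial (evenExp e W) 1 - monomial (oddExp e W) 1

/-- A primitive even closed walk: the only closed subwalks of even length are the walks of length
zero and the walk itself. Going back and forth along one edge (length two) does not count. -/
def IsPrimitive {v : V} (W : G.Walk v v) : Prop :=
  2 < W.length ∧ Even W.length ∧
    ∀ (u : V) (Q : G.Walk u u), Q.IsSubwalk W → Even Q.length →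
      Q.length = 0 ∨ Q.length = W.length

/-- The stronger form of primitivity in which the edges of the smaller even closed walk need not
be consecutive in `W`: no shorter even closed walk `Q` of positive length has its odd edges among
the odd edges of `W` and its even edges among the even edges of `W` (with multiplicities). -/
def IsStronglyPrimitive (e : Fin r ≃ G.edgeSet) {v : V} (W : G.Walk v v) : Prop :=
  2 < W.length ∧ Even W.length ∧
    ∀ (u : V) (Q : G.Walk u u), Even Q.length → oddExp e Q ≤ oddExp e W →
      evenExp e Q ≤ evenExp e W → Q.length = 0 ∨ Q.length = W.length

/-- The `t × t` matrix with diagonal `T_2, T_4, …, T_{2t}`, with `-T_1, -T_3, …, -T_{2t-3}` below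
the diagonal, `-T_{2t-1}` in the upper right corner, and zeros elsewhere (used for `2 ≤ t`).
The entry `T_i` is `a (i - 1)`. -/
def cyclicMatrix {A : Type*} [CommRing A] {t : ℕ} (a : Fin (2 * t) → A) :
    Matrix (Fin t) (Fin t) A := fun i j =>
  if i = j then a ⟨2 * j + 1, by omega⟩
  else if (i : ℕ) = (j + 1) % t then -a ⟨2 * j, by omega⟩
  else 0

/-- `M` becomes the cyclic matrix on `a` after rearranging rows and columns and changing the signs
of some columns (the signs of the columns depend on the enumeration of the edges). -/
def IsCyclicForm {A : Type*} [CommRing A] {t : ℕ} (M : Matrix (Fin t) (Fin t) A)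
    (a : Fin (2 * t) → A) : Prop :=
  ∃ (σ τ : Equiv.Perm (Fin t)) (ε : Fin t → ℤˣ),
    ∀ i j, M (σ i) (τ j) = ((ε j : ℤ) : A) * cyclicMatrix a i j

/-- The binomial of the walk `W`, of length `2t`, is the determinant of a `t × t` submatrix of `D`
which is of the cyclic form on the variables of the edges of `W`. -/
def IsCyclicMinor {k : Type*} [Field k] {C : Type*} (e : Fin r ≃ G.edgeSet)
    (D : Matrix V C (MvPolynomial (Fin r) k)) {v : V} (W : G.Walk v v) : Prop :=
  ∃ (t : ℕ) (ht : W.length = 2 * t) (rows : Fin t → V) (cols : Fin t → C),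
    rows.Injective ∧ cols.Injective ∧
    IsCyclicForm (D.submatrix rows cols) (fun i => X (edgeIdx e W (Fin.cast ht.symm i))) ∧
    (D.submatrix rows cols).det = walkBinomial k e W

end

end EdgeRees

/-! The presentation sends monomials to monomials, so `J` is generated by the differences of
monomials `x^a T^α` with equal image, i.e. of `Balanced` pairs (`definingIdeal_le`). A variable
`T_i` common to both monomials cancels. If there is none and the `x`-parts differ, a multiple of a
linear relation trades one `T` of the first monomial for one of the second (`exists_exchange`). If
the `x`-parts agree, the edge multisets `α` and `β` have the same vertex degrees. An alternating
walk between them can then be prolonged until it closes up evenly; a shortest such closed walk is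
strongly primitive (`exists_isStronglyPrimitive_le`), and its binomial performs the trade. Either
way a common variable appears. This reduction is `bimonomial_sub_mem_of_reduction`, and induction on
the `T`-degree turns it into generation.

For minimal systems, give `x_v` weight 1 and `T_i` weight 2. Balanced differences are homogeneous,
so a generator is useless for elements of smaller weight (`IsMinimalBinomialSystem.mem_span_diff`).
Applied to a generator `f`, the same reduction uses only multiples of balanced differences of
smaller weight, making `f` redundant, unless `f` is linear or is itself a walk binomial.

For the minors, two consecutive edges `pq`, `qw` of a walk with `p ≠ w` give a column of the reduced
Jacobian dual with `T_{qw}` in row `p`, `-T_{pq}` in row `w` and zeros elsewhere, up to a common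
sign. The vertices in even position and the successive pairs of edges then form the cyclic matrix;
primitivity keeps its rows and columns distinct, and its determinant has just two terms. -/

namespace EdgeRees

noncomputable section

variable {V : Type*} {G : SimpleGraph V} {r : ℕ}

/-! ### Alternating edge exponents of walks, and existence of strongly primitive walks -/

section Walks

variable (e : Fin r ≃ G.edgeSet)

@[simp]
theorem oddExp_nil (u : V) : oddExp e (SimpleGraph.Walk.nil : G.Walk u u) = 0 := by
  simp only [oddExp]
  exact Finset.sum_eq_zero fun i _ => i.elim0

@[simp]
theorem evenExp_nil (u : V) : evenExp e (SimpleGraph.Walk.nil : G.Walk u u) = 0 := by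
  simp only [evenExp]
  exact Finset.sum_eq_zero fun i _ => i.elim0

theorem edgeIdx_cons_succ {u v w : V} (h : G.Adj u v) (p : G.Walk v w) (i : Fin p.length) :
    edgeIdx e (SimpleGraph.Walk.cons h p) (Fin.succ i) = edgeIdx e p i := by
  simp [edgeIdx]

@[simp]
theorem oddExp_cons {u v w : V} (h : G.Adj u v) (p : G.Walk v w) :
    oddExp e (SimpleGraph.Walk.cons h p) =
      Finsupp.single (e.symm ⟨s(u, v), h⟩) 1 + evenExp e p := by
  simp only [oddExp, evenExp, Finset.sum_filter]
  refine (Fin.sum_univ_succ (n := p.length) _).trans ?_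
  congr 1
  · simp [edgeIdx]
  · refine Finset.sum_congr rfl fun i _ => ?_
    rw [edgeIdx_cons_succ]
    simp [Nat.even_add_one]

@[simp]
theorem evenExp_cons {u v w : V} (h : G.Adj u v) (p : G.Walk v w) :
    evenExp e (SimpleGraph.Walk.cons h p) = oddExp e p := by
  simp only [oddExp, evenExp, Finset.sum_filter]
  refine (Fin.sum_univ_succ (n := p.length) _).trans ?_
  rw [if_neg (by simp), zero_add]
  refine Finset.sum_congr rfl fun i _ => ?_
  rw [edgeIdx_cons_succ]
  simp [Nat.odd_add_one]

theorem degree_oddExp_add_degree_evenExp {u v : V} (W : G.Walk u v) :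
    (oddExp e W).degree + (evenExp e W).degree = W.length := by
  induction W with
  | nil => simp
  | cons h p ih =>
    simp only [oddExp_cons, evenExp_cons, map_add, Finsupp.degree_single,
      SimpleGraph.Walk.length_cons]
    omega

theorem degree_oddExp {u v : V} (W : G.Walk u v) :
    (oddExp e W).degree = (W.length + 1) / 2 := by
  induction W with
  | nil => simp
  | cons h p ih =>
    have := degree_oddExp_add_degree_evenExp e p
    simp only [oddExp_cons, map_add, Finsupp.degree_single, SimpleGraph.Walk.length_cons]
    omega

theorem degree_oddExp_of_even {u v : V} {W : G.Walk u v} (hW : Even W.length) :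
    2 * (oddExp e W).degree = W.length := by
  have := degree_oddExp e W
  have := Nat.even_iff.mp hW
  omega

theorem degree_oddExp_eq_degree_evenExp {u v : V} {W : G.Walk u v} (hW : Even W.length) :
    (oddExp e W).degree = (evenExp e W).degree := by
  have := degree_oddExp_of_even e hW
  have := degree_oddExp_add_degree_evenExp e W
  omega

/-- An odd first piece shifts the positions in `q` by an odd number and so exchanges its two edge
classes. Both parities are proved together because each inductive step passes from one to the other.
-/
theorem oddExp_evenExp_append {u v w : V} (p : G.Walk u v) (q : G.Walk v w) :
    (Even p.length → oddExp e (p.append q) = oddExp e p + oddExp e q ∧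
      evenExp e (p.append q) = evenExp e p + evenExp e q) ∧
    (Odd p.length → oddExp e (p.append q) = oddExp e p + evenExp e q ∧
      evenExp e (p.append q) = evenExp e p + oddExp e q) := by
  induction p with
  | nil => simp
  | cons h p ih =>
    obtain ⟨ih₁, ih₂⟩ := ih q
    simp only [SimpleGraph.Walk.length_cons, SimpleGraph.Walk.cons_append, oddExp_cons,
      evenExp_cons, Nat.even_add_one, Nat.odd_add_one, Nat.not_even_iff_odd, Nat.not_odd_iff_even]
    refine ⟨fun hp => ?_, fun hp => ?_⟩
    · rw [(ih₂ hp).1, (ih₂ hp).2, add_assoc]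
      exact ⟨rfl, rfl⟩
    · rw [(ih₁ hp).1, (ih₁ hp).2, add_assoc]
      exact ⟨rfl, rfl⟩

theorem oddExp_evenExp_reverse {u v : V} (p : G.Walk u v) :
    (Even p.length → oddExp e p.reverse = evenExp e p ∧ evenExp e p.reverse = oddExp e p) ∧
    (Odd p.length → oddExp e p.reverse = oddExp e p ∧ evenExp e p.reverse = evenExp e p) := by
  induction p with
  | nil => simp
  | @cons a b c h p ih =>
    obtain ⟨ih₁, ih₂⟩ := ih
    have hs : e.symm ⟨s(b, a), h.symm⟩ = e.symm ⟨s(a, b), h⟩ := by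
      congr 2
      exact Sym2.eq_swap
    simp only [SimpleGraph.Walk.length_cons, SimpleGraph.Walk.reverse_cons, oddExp_cons,
      evenExp_cons, Nat.even_add_one, Nat.odd_add_one, Nat.not_even_iff_odd, Nat.not_odd_iff_even]
    obtain ⟨h₁, h₂⟩ := oddExp_evenExp_append e p.reverse
      (SimpleGraph.Walk.cons h.symm SimpleGraph.Walk.nil)
    rw [SimpleGraph.Walk.length_reverse] at h₁ h₂
    refine ⟨fun hp => ?_, fun hp => ?_⟩
    · rw [(h₂ hp).1, (h₂ hp).2, (ih₂ hp).1, (ih₂ hp).2]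
      simp [hs, add_comm]
    · rw [(h₁ hp).1, (h₁ hp).2, (ih₁ hp).1, (ih₁ hp).2]
      simp [hs, add_comm]

theorem IsStronglyPrimitive.reverse {e : Fin r ≃ G.edgeSet} {v : V} {W : G.Walk v v}
    (hW : IsStronglyPrimitive e W) : IsStronglyPrimitive e W.reverse := by
  obtain ⟨h2, hev, h⟩ := hW
  refine ⟨by simpa using h2, by simpa using hev, fun u Q hQ ho hE => ?_⟩
  rw [((oddExp_evenExp_reverse e W).1 hev).1] at ho
  rw [((oddExp_evenExp_reverse e W).1 hev).2] at hE
  have := h u Q.reverse (by simpa using hQ)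
    (by rwa [((oddExp_evenExp_reverse e Q).1 hQ).1])
    (by rwa [((oddExp_evenExp_reverse e Q).1 hQ).2])
  simpa using this

/-- An even closed subwalk starting at an even position inherits the edge classes of `W`. One
starting at an odd position has them exchanged, and reversing it exchanges them back, so strong
primitivity applies to the reverse. -/
theorem IsStronglyPrimitive.isPrimitive {e : Fin r ≃ G.edgeSet} {v : V} {W : G.Walk v v}
    (hW : IsStronglyPrimitive e W) : IsPrimitive W := by
  obtain ⟨h2, hev, h⟩ := hW
  refine ⟨h2, hev, fun u Q hQW hQ => ?_⟩
  obtain ⟨p, q, hpq⟩ := hQW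
  obtain ⟨-, hQodd⟩ := oddExp_evenExp_append e p Q
  obtain ⟨hQeven, -⟩ := oddExp_evenExp_append e p Q
  obtain ⟨h₁, h₂⟩ := oddExp_evenExp_append e (p.append Q) q
  rw [SimpleGraph.Walk.length_append, ← hpq] at h₁ h₂
  rcases Nat.even_or_odd p.length with hp | hp
  · have hp' := h₁ (hp.add hQ)
    rw [(hQeven hp).1, (hQeven hp).2] at hp'
    refine h u Q hQ ?_ ?_
    · rw [hp'.1, add_assoc]
      exact le_add_left le_self_add
    · rw [hp'.2, add_assoc]
      exact le_add_left le_self_add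
  · have hp' := h₂ (hp.add_even hQ)
    rw [(hQodd hp).1, (hQodd hp).2] at hp'
    have hrev := (oddExp_evenExp_reverse e Q).1 hQ
    have := h u Q.reverse (by simpa using hQ) ?_ ?_
    · simpa using this
    · rw [hrev.1, hp'.1, add_assoc]
      exact le_add_left le_self_add
    · rw [hrev.2, hp'.2, add_assoc]
      exact le_add_left le_self_add

/-- Were the exponents equal, the first edge would occur in both classes, and going back and forth
along it would be a forbidden walk of length two. -/
theorem IsStronglyPrimitive.oddExp_ne_evenExp {e : Fin r ≃ G.edgeSet} {v : V} {W : G.Walk v v}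
    (hW : IsStronglyPrimitive e W) : oddExp e W ≠ evenExp e W := by
  obtain ⟨h2, hev, h⟩ := hW
  intro heq
  cases W with
  | nil => simp at h2
  | @cons _ b _ hvb p =>
    have hs : e.symm ⟨s(b, v), hvb.symm⟩ = e.symm ⟨s(v, b), hvb⟩ := by
      congr 2
      exact Sym2.eq_swap
    have := h v (SimpleGraph.Walk.cons hvb (SimpleGraph.Walk.cons hvb.symm SimpleGraph.Walk.nil))
      (by simp) (by simp) (by
        rw [← heq]
        simp [hs])
    simp only [SimpleGraph.Walk.length_cons, SimpleGraph.Walk.length_nil] at this h2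
    omega

/-- The exponent of the monomial `∏ f_i ^ α_i`. -/
def vertexExp : (Fin r →₀ ℕ) →ₗ[ℕ] (V →₀ ℕ) := Finsupp.linearCombination ℕ (genExp e)

@[simp]
theorem vertexExp_single (i : Fin r) : vertexExp e (Finsupp.single i 1) = genExp e i := by
  simp [vertexExp]

@[simp]
theorem genExp_symm_mk {u v : V} (h : G.Adj u v) :
    genExp e (e.symm ⟨s(u, v), h⟩) = Finsupp.single u 1 + Finsupp.single v 1 := by
  simp [genExp, edgeExp]

/-- The alternating sum of the edge monomials telescopes: every inner vertex is covered once by an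
odd and once by an even step, so only the two ends contribute. -/
theorem vertexExp_oddExp_evenExp {u v : V} (W : G.Walk u v) :
    (Even W.length → vertexExp e (oddExp e W) + Finsupp.single v 1 =
      vertexExp e (evenExp e W) + Finsupp.single u 1) ∧
    (Odd W.length → vertexExp e (oddExp e W) =
      vertexExp e (evenExp e W) + Finsupp.single u 1 + Finsupp.single v 1) := by
  induction W with
  | nil => simp
  | cons h p ih =>
    obtain ⟨ih₁, ih₂⟩ := ih
    simp only [SimpleGraph.Walk.length_cons, oddExp_cons, map_add, vertexExp_single,
      genExp_symm_mk, evenExp_cons, Nat.even_add_one, Nat.odd_add_one, Nat.not_even_iff_odd,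
      Nat.not_odd_iff_even]
    refine ⟨fun hp => ?_, fun hp => ?_⟩
    · rw [ih₂ hp]
      abel
    · rw [add_right_comm (vertexExp e (oddExp e p)), ih₁ hp]
      abel

theorem vertexExp_oddExp_eq_evenExp {v : V} {W : G.Walk v v} (hW : Even W.length) :
    vertexExp e (oddExp e W) = vertexExp e (evenExp e W) :=
  add_right_cancel ((vertexExp_oddExp_evenExp e W).1 hW)

theorem degree_genExp (i : Fin r) : (genExp e i).degree = 2 := by
  unfold genExp
  induction (e i : Sym2 V) with | _ u v =>
  simp [edgeExp]

theorem degree_vertexExp (α : Fin r →₀ ℕ) : (vertexExp e α).degree = 2 * α.degree := by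
  induction α using Finsupp.induction_linear with
  | zero => simp
  | add f g hf hg => simp only [map_add, hf, hg]; ring
  | single i n =>
    simp [vertexExp, degree_genExp, mul_comm]

theorem exists_edge_eq_of_genExp_pos {i : Fin r} {w : V} (h : 0 < genExp e i w) :
    ∃ z, ∃ hz : G.Adj w z, e.symm ⟨s(w, z), hz⟩ = i := by
  classical
  have hi : ∃ z, (e i : Sym2 V) = s(w, z) := by
    unfold genExp at h
    revert h
    induction (e i : Sym2 V) with | _ u v =>
    intro h
    simp only [edgeExp, Sym2.lift_mk, Finsupp.add_apply, Finsupp.single_apply] at h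
    by_cases hu : u = w
    · exact ⟨v, by rw [hu]⟩
    · by_cases hv : v = w
      · exact ⟨u, by rw [hv]; exact Sym2.eq_swap⟩
      · simp [hu, hv] at h
  obtain ⟨z, hz⟩ := hi
  have hadj : s(w, z) ∈ G.edgeSet := hz ▸ (e i).2
  refine ⟨z, hadj, ?_⟩
  rw [Equiv.symm_apply_eq]
  exact Subtype.ext hz.symm

theorem exists_edge_of_vertexExp_pos {α : Fin r →₀ ℕ} {w : V} (h : 0 < vertexExp e α w) :
    ∃ z, ∃ hz : G.Adj w z, 0 < α (e.symm ⟨s(w, z), hz⟩) := by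
  have h' : ∃ i, 0 < α i ∧ 0 < genExp e i w := by
    by_contra! hcon
    refine h.ne' ?_
    simp only [vertexExp, Finsupp.linearCombination_apply, Finsupp.sum, Finsupp.finsetSum_apply,
      Finsupp.smul_apply, smul_eq_mul]
    refine Finset.sum_eq_zero fun i hi => ?_
    rw [Nat.le_zero.mp (hcon i (Nat.pos_of_ne_zero (Finsupp.mem_support_iff.mp hi))), mul_zero]
  obtain ⟨i, hi, hw⟩ := h'
  obtain ⟨z, hz, rfl⟩ := exists_edge_eq_of_genExp_pos e hw
  exact ⟨z, hz, hi⟩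

theorem single_le_sub_of_pos {ι : Type*} {α γ : ι →₀ ℕ} (h : γ ≤ α) {i : ι} (hi : 0 < (α - γ) i) :
    γ + Finsupp.single i 1 ≤ α := by
  classical
  intro j
  have := h j
  simp only [Finsupp.tsub_apply] at hi
  simp only [Finsupp.add_apply, Finsupp.single_apply]
  split_ifs with hij
  · subst hij
    omega
  · omega

/-- If `∏ f_i ^ α_i = ∏ f_i ^ β_i`, then an alternating walk of maximal length starting with an
edge of `α` is closed and of even length. -/
theorem exists_closed_walk_le {α β : Fin r →₀ ℕ} (hαβ : vertexExp e α = vertexExp e β)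
    (hα : α ≠ 0) :
    ∃ (u : V) (Q : G.Walk u u), 0 < Q.length ∧ Even Q.length ∧
      oddExp e Q ≤ α ∧ evenExp e Q ≤ β := by
  classical
  obtain ⟨i, hi⟩ := Finsupp.ne_iff.mp hα
  obtain ⟨⟨u, v⟩, huv⟩ : ∃ p : V × V, (e i : Sym2 V) = s(p.1, p.2) := by
    induction (e i : Sym2 V) with | _ u v =>
    exact ⟨(u, v), rfl⟩
  have hadj : G.Adj u v := by
    have := (e i).2
    rwa [huv] at this
  have hei : e.symm ⟨s(u, v), hadj⟩ = i := by
    rw [Equiv.symm_apply_eq]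
    exact Subtype.ext huv.symm
  let P : ℕ → Prop := fun n => ∃ (w : V) (W : G.Walk u w), W.length = n ∧
    oddExp e W ≤ α ∧ evenExp e W ≤ β
  have hbound : ∀ n, P n → n ≤ α.degree + β.degree := by
    rintro n ⟨w, W, rfl, ho, hE⟩
    rw [← degree_oddExp_add_degree_evenExp e W]
    exact add_le_add (Finsupp.degree_mono ho) (Finsupp.degree_mono hE)
  have hP1 : P 1 := by
    refine ⟨v, SimpleGraph.Walk.cons hadj SimpleGraph.Walk.nil, rfl, ?_, by simp⟩
    simp only [oddExp_cons, evenExp_nil, add_zero, hei, Finsupp.single_le_iff]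
    exact Nat.one_le_iff_ne_zero.mpr hi
  set N := Nat.findGreatest P (α.degree + β.degree) with hN
  have hPN : P N := Nat.findGreatest_spec (hbound 1 hP1) hP1
  have hN1 : 1 ≤ N := Nat.le_findGreatest (hbound 1 hP1) hP1
  have hmax : ¬ P (N + 1) := fun h => by
    have := Nat.le_findGreatest (hbound _ h) h
    omega
  obtain ⟨w, W, hWN, ho, hE⟩ := hPN
  have hbal := vertexExp_oddExp_evenExp e W
  have hα' : vertexExp e α = vertexExp e (oddExp e W) + vertexExp e (α - oddExp e W) := by
    rw [← map_add, add_tsub_cancel_of_le ho]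
  have hβ' : vertexExp e β = vertexExp e (evenExp e W) + vertexExp e (β - evenExp e W) := by
    rw [← map_add, add_tsub_cancel_of_le hE]
  rw [hα', hβ'] at hαβ
  have hw := DFunLike.congr_fun hαβ w
  simp only [Finsupp.add_apply] at hw
  -- At the end `w` of a maximal walk, the telescoped balance shows that the class to be used next
  -- still has an unused edge at `w`, unless the walk is even and closed. Such an edge would prolong
  -- the walk.
  rcases Nat.even_or_odd W.length with hWe | hWo
  · by_cases huw : u = w
    · subst huw
      exact ⟨u, W, by omega, hWe, ho, hE⟩
    · exfalso
      have hb := DFunLike.congr_fun (hbal.1 hWe) w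
      simp only [Finsupp.add_apply, Finsupp.single_eq_same,
        Finsupp.single_eq_of_ne (Ne.symm huw)] at hb
      obtain ⟨z, hz, hzα⟩ := exists_edge_of_vertexExp_pos e (α := α - oddExp e W) (w := w)
        (by omega)
      have happ := (oddExp_evenExp_append e W
        (SimpleGraph.Walk.cons hz SimpleGraph.Walk.nil)).1 hWe
      refine hmax ⟨z, W.append (SimpleGraph.Walk.cons hz SimpleGraph.Walk.nil), by simp [hWN],
        ?_, ?_⟩
      · rw [happ.1]
        simpa using single_le_sub_of_pos ho hzα
      · rw [happ.2]
        simpa using hE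
  · exfalso
    have hb := DFunLike.congr_fun (hbal.2 hWo) w
    simp only [Finsupp.add_apply, Finsupp.single_eq_same] at hb
    obtain ⟨z, hz, hzβ⟩ := exists_edge_of_vertexExp_pos e (α := β - evenExp e W) (w := w)
      (by omega)
    have happ := (oddExp_evenExp_append e W
      (SimpleGraph.Walk.cons hz SimpleGraph.Walk.nil)).2 hWo
    refine hmax ⟨z, W.append (SimpleGraph.Walk.cons hz SimpleGraph.Walk.nil), by simp [hWN],
      ?_, ?_⟩
    · rw [happ.1]
      simpa using ho
    · rw [happ.2]
      simpa using single_le_sub_of_pos hE hzβ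

/-- A shortest alternating even closed walk is strongly primitive. -/
theorem exists_isStronglyPrimitive_le {α β : Fin r →₀ ℕ} (hαβ : vertexExp e α = vertexExp e β)
    (hα : α ≠ 0) (hdisj : ∀ i, α i = 0 ∨ β i = 0) :
    ∃ (u : V) (Q : G.Walk u u), IsStronglyPrimitive e Q ∧ oddExp e Q ≤ α ∧ evenExp e Q ≤ β := by
  classical
  let P : ℕ → Prop := fun n => ∃ (u : V) (Q : G.Walk u u), Q.length = n ∧ 0 < Q.length ∧
    Even Q.length ∧ oddExp e Q ≤ α ∧ evenExp e Q ≤ β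
  have hex : ∃ n, P n := by
    obtain ⟨u, Q, h⟩ := exists_closed_walk_le e hαβ hα
    exact ⟨_, u, Q, rfl, h⟩
  obtain ⟨u, Q, hQn, hQ0, hQe, ho, hE⟩ := Nat.find_spec hex
  refine ⟨u, Q, ⟨?_, hQe, fun u' Q' hQ'e ho' hE' => ?_⟩, ho, hE⟩
  -- A closed walk of length two uses one edge in both classes, which disjointness of `α` and `β`
  -- forbids.
  · by_contra hlt
    have hlen : Q.length = 2 := by
      have := Nat.even_iff.mp hQe
      omega
    cases Q with
    | nil => simp at hlen
    | @cons _ b _ hub p =>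
      cases p with
      | nil => simp at hlen
      | cons hbc p =>
        cases p with
        | cons _ _ => simp at hlen
        | nil =>
          have hs : e.symm ⟨s(b, u), hbc⟩ = e.symm ⟨s(u, b), hub⟩ := by
            congr 2
            exact Sym2.eq_swap
          simp only [oddExp_cons, evenExp_cons, oddExp_nil, evenExp_nil, add_zero,
            Finsupp.single_le_iff, hs] at ho hE
          rcases hdisj (e.symm ⟨s(u, b), hub⟩) with h | h <;> omega
  · by_contra! hne
    have hle : Q'.length ≤ Q.length := by
      rw [← degree_oddExp_of_even e hQ'e, ← degree_oddExp_of_even e hQe]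
      exact Nat.mul_le_mul_left _ (Finsupp.degree_mono ho')
    have := Nat.find_min' hex
      ⟨u', Q', rfl, Nat.pos_of_ne_zero hne.1, hQ'e, ho'.trans ho, hE'.trans hE⟩
    rw [← hQn] at this
    exact hne.2 (le_antisymm hle this)

end Walks

/-! ### The defining ideal as a toric ideal, and the exchange reduction -/

section Toric

variable (k : Type*) [Field k]

/-- The monomial `x^a T^α` of `R[T]`. -/
def bimonomial (α : Fin r →₀ ℕ) (a : V →₀ ℕ) : MvPolynomial (Fin r) (MvPolynomial V k) :=
  monomial α (monomial a 1)

theorem bimonomial_mul (α β : Fin r →₀ ℕ) (a b : V →₀ ℕ) :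
    bimonomial k α a * bimonomial k β b = bimonomial k (α + β) (a + b) := by
  simp [bimonomial, monomial_mul]

/-- The `k`-basis of `R[T]` consisting of the monomials. -/
def bimonomialBasis (V : Type*) (r : ℕ) : Module.Basis ((V →₀ ℕ) × (Fin r →₀ ℕ)) k
    (MvPolynomial (Fin r) (MvPolynomial V k)) :=
  (basisMonomials V k).smulTower (basisMonomials (Fin r) (MvPolynomial V k))

theorem bimonomialBasis_apply (p : (V →₀ ℕ) × (Fin r →₀ ℕ)) :
    bimonomialBasis k V r p = bimonomial k p.2 p.1 := by
  simp [bimonomialBasis, bimonomial, Module.Basis.smulTower_apply, smul_monomial]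

variable (e : Fin r ≃ G.edgeSet)

/-- Two monomials of `R[T]` have the same image in the Rees algebra. -/
def Balanced (α : Fin r →₀ ℕ) (a : V →₀ ℕ) (β : Fin r →₀ ℕ) (b : V →₀ ℕ) : Prop :=
  vertexExp e α + a = vertexExp e β + b ∧ α.degree = β.degree

theorem coe_reesPresentation (p : MvPolynomial (Fin r) (MvPolynomial V k)) :
    (reesPresentation k e p : Polynomial (MvPolynomial V k)) =
      aeval (fun i => Polynomial.monomial 1 (edgeGen k e i)) p := by
  have h : (reesAlgebra (edgeIdeal k e)).val.comp (reesPresentation k e) =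
      aeval (fun i => Polynomial.monomial 1 (edgeGen k e i)) := by
    rw [reesPresentation, comp_aeval]
    rfl
  exact DFunLike.congr_fun h p

theorem coe_reesPresentation_bimonomial (α : Fin r →₀ ℕ) (a : V →₀ ℕ) :
    (reesPresentation k e (bimonomial k α a) : Polynomial (MvPolynomial V k)) =
      Polynomial.monomial α.degree (monomial (vertexExp e α + a) 1) := by
  have hα : α.prod (fun i n => (Polynomial.monomial 1 (edgeGen k e i)) ^ n) =
      Polynomial.monomial α.degree (monomial (vertexExp e α) (1 : k)) := by
    induction α using Finsupp.induction_linear with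
    | zero => simp
    | add f g hf hg =>
      rw [Finsupp.prod_add_index' (by simp) (fun _ _ _ => pow_add _ _ _), hf, hg,
        Polynomial.monomial_mul_monomial, monomial_mul, map_add, map_add, one_mul]
    | single i n =>
      rw [Finsupp.prod_single_index (by simp), Polynomial.monomial_pow, edgeGen, monomial_pow]
      simp [vertexExp]
  rw [coe_reesPresentation, bimonomial, aeval_monomial, hα, Polynomial.algebraMap_eq,
    Polynomial.C_mul_monomial, monomial_mul, one_mul, add_comm]

theorem mem_definingIdeal_iff (p : MvPolynomial (Fin r) (MvPolynomial V k)) :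
    p ∈ definingIdeal k e ↔ (reesPresentation k e p : Polynomial (MvPolynomial V k)) = 0 := by
  rw [definingIdeal, RingHom.mem_ker]
  exact (ZeroMemClass.coe_eq_zero).symm

theorem bimonomial_sub_mem_definingIdeal_iff (α β : Fin r →₀ ℕ) (a b : V →₀ ℕ) :
    bimonomial k α a - bimonomial k β b ∈ definingIdeal k e ↔ Balanced e α a β b := by
  rw [mem_definingIdeal_iff, map_sub, AddSubgroupClass.coe_sub, coe_reesPresentation_bimonomial,
    coe_reesPresentation_bimonomial, sub_eq_zero]
  constructor
  · intro h
    rw [Polynomial.monomial_eq_monomial_iff] at h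
    rcases h with ⟨hd, h⟩ | ⟨h, -⟩
    · rw [monomial_eq_monomial_iff] at h
      rcases h with ⟨h, -⟩ | ⟨h, -⟩
      · exact ⟨h, hd⟩
      · exact absurd h one_ne_zero
    · exact absurd h (by simp)
  · rintro ⟨h, hd⟩
    rw [h, hd]

/-- The kernel of a monomial map is generated by differences of monomials. -/
theorem definingIdeal_le {K : Ideal (MvPolynomial (Fin r) (MvPolynomial V k))}
    (hK : ∀ α β a b, Balanced e α a β b → bimonomial k α a - bimonomial k β b ∈ K) :
    definingIdeal k e ≤ K := by
  classical
  let D : (V →₀ ℕ) × (Fin r →₀ ℕ) → (V →₀ ℕ) × ℕ := fun p => (vertexExp e p.2 + p.1, p.2.degree)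
  -- `s` picks one monomial in each nonempty fibre. Modulo `K` the choice is immaterial, so `Ψ`
  -- recovers the class of `p` from `θ p`, and `θ p = 0` forces `p ∈ K`.
  let s : (V →₀ ℕ) × ℕ → (V →₀ ℕ) × (Fin r →₀ ℕ) := Function.invFun D
  have hs : ∀ p, D (s (D p)) = D p := fun p => Function.invFun_eq ⟨p, rfl⟩
  let Ψ : Polynomial (MvPolynomial V k) →ₗ[k] (MvPolynomial (Fin r) (MvPolynomial V k) ⧸ K) :=
    Polynomial.lsum fun n => (basisMonomials V k).constr k fun b =>
      Ideal.Quotient.mk K (bimonomial k (s (b, n)).2 (s (b, n)).1)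
  let θ : MvPolynomial (Fin r) (MvPolynomial V k) →ₗ[k] Polynomial (MvPolynomial V k) :=
    (aeval (R := MvPolynomial V k)
      (fun i => Polynomial.monomial 1 (edgeGen k e i))).toLinearMap.restrictScalars k
  have hcomp : Ψ ∘ₗ θ = (Ideal.Quotient.mkₐ k K).toLinearMap := by
    refine (bimonomialBasis k V r).ext fun p => ?_
    have h1 : θ (bimonomial k p.2 p.1) =
        Polynomial.monomial p.2.degree (monomial (vertexExp e p.2 + p.1) 1) := by
      rw [← coe_reesPresentation_bimonomial, coe_reesPresentation]
      rfl
    have h2 := (basisMonomials V k).constr_basis k (fun b => Ideal.Quotient.mk K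
      (bimonomial k (s (b, p.2.degree)).2 (s (b, p.2.degree)).1)) (vertexExp e p.2 + p.1)
    rw [bimonomialBasis_apply, LinearMap.comp_apply, h1]
    simp only [Ψ, Polynomial.lsum_apply]
    rw [Polynomial.sum_monomial_index _ _ (by simp)]
    rw [coe_basisMonomials] at h2
    rw [h2]
    refine Ideal.Quotient.eq.mpr (hK _ _ _ _ ?_)
    have := hs p
    exact ⟨congrArg Prod.fst this, congrArg Prod.snd this⟩
  intro p hp
  rw [mem_definingIdeal_iff, coe_reesPresentation] at hp
  have h3 : θ p = 0 := hp
  have h4 := LinearMap.congr_fun hcomp p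
  rw [LinearMap.comp_apply, h3, map_zero] at h4
  exact Ideal.Quotient.eq_zero_iff_mem.mp h4.symm

theorem X_mul_C_eq_monomial {σ A : Type*} [CommSemiring A] (i : σ) (f : A) :
    X i * C f = monomial (Finsupp.single i 1) f := by
  rw [X, mul_comm, C_mul_monomial, mul_one]

theorem linearEquations_taylorMatrix (c : TaylorCol r) :
    linearEquations (taylorMatrix k e) c =
      bimonomial k (Finsupp.single c.1.2 1) ((genExp e c.1.1 ⊔ genExp e c.1.2) - genExp e c.1.2) -
      bimonomial k (Finsupp.single c.1.1 1)
        ((genExp e c.1.1 ⊔ genExp e c.1.2) - genExp e c.1.1) := by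
  have hc : c.1.1 ≠ c.1.2 := c.2.ne
  simp only [linearEquations, Matrix.vecMul, dotProduct, Matrix.map_apply, bimonomial,
    X_mul_C_eq_monomial]
  rw [Finset.sum_eq_add_of_mem c.1.1 c.1.2 (Finset.mem_univ _) (Finset.mem_univ _) hc]
  · simp only [taylorMatrix, if_true, if_neg hc.symm, map_neg]
    ring
  · rintro i - ⟨h1, h2⟩
    simp [taylorMatrix, h1, h2]

theorem linearEquations_mem_definingIdeal (c : TaylorCol r) :
    linearEquations (taylorMatrix k e) c ∈ definingIdeal k e := by
  rw [linearEquations_taylorMatrix, bimonomial_sub_mem_definingIdeal_iff]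
  refine ⟨?_, by simp⟩
  rw [vertexExp_single, vertexExp_single, add_tsub_cancel_of_le le_sup_right,
    add_tsub_cancel_of_le le_sup_left]

/-- Every relation of degree one between two generators is a multiple of a Taylor relation. -/
theorem bimonomial_single_sub_mem (i j : Fin r) (c d : V →₀ ℕ)
    (h : genExp e i + c = genExp e j + d) :
    bimonomial k (Finsupp.single i 1) c - bimonomial k (Finsupp.single j 1) d ∈
      Ideal.span (Set.range (linearEquations (taylorMatrix k e))) := by
  have key : ∀ (i j : Fin r) (c d : V →₀ ℕ), i < j → genExp e i + c = genExp e j + d →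
      bimonomial k (Finsupp.single j 1) d - bimonomial k (Finsupp.single i 1) c ∈
      Ideal.span (Set.range (linearEquations (taylorMatrix k e))) := by
    intro i j c d hij h
    set m := genExp e i ⊔ genExp e j with hm
    have hle : m ≤ genExp e i + c := sup_le le_self_add (h ▸ le_self_add)
    have hc : c = (genExp e i + c - m) + (m - genExp e i) := by
      rw [tsub_add_tsub_cancel hle le_sup_left, add_tsub_cancel_left]
    have hd : d = (genExp e i + c - m) + (m - genExp e j) := by
      rw [tsub_add_tsub_cancel hle le_sup_right, h, add_tsub_cancel_left]
    have heq : bimonomial k (Finsupp.single j 1) d - bimonomial k (Finsupp.single i 1) c =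
        bimonomial k 0 (genExp e i + c - m) *
          linearEquations (taylorMatrix k e) ⟨(i, j), hij⟩ := by
      rw [linearEquations_taylorMatrix, mul_sub, bimonomial_mul, bimonomial_mul, zero_add,
        zero_add]
      simp only [← hm]
      rw [← hc, ← hd]
    rw [heq]
    exact Ideal.mul_mem_left _ _ (Ideal.subset_span (Set.mem_range_self _))
  rcases lt_trichotomy i j with hij | rfl | hij
  · rw [← neg_sub]
    exact neg_mem (key i j c d hij h)
  · rw [add_left_cancel h, sub_self]
    exact zero_mem _
  · exact key j i d c hij h.symm

/-- If the `x`-parts of two monomials with the same image differ, a linear relation replaces a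
variable of the first monomial by a variable of the second one. -/
theorem exists_exchange {α β : Fin r →₀ ℕ} {a b : V →₀ ℕ} (h : Balanced e α a β b) (hab : a ≠ b) :
    ∃ (i j : Fin r) (c d : V →₀ ℕ), 0 < α i ∧ 0 < β j ∧ c ≤ a ∧
      genExp e i + c = genExp e j + d := by
  classical
  obtain ⟨hv, hd⟩ := h
  have hdeg : a.degree = b.degree := by
    have := congrArg Finsupp.degree hv
    rw [map_add, map_add, degree_vertexExp, degree_vertexExp, hd] at this
    omega
  obtain ⟨v, hbv⟩ : ∃ v, b v < a v := by
    by_contra! hcon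
    refine hab ?_
    have hle : a ≤ b := hcon
    have h1 : a + (b - a) = b := add_tsub_cancel_of_le hle
    have h2 := congrArg Finsupp.degree h1
    rw [map_add, hdeg] at h2
    have h3 : (b - a).degree = 0 := by omega
    rw [Finsupp.degree_eq_zero_iff] at h3
    rw [← h1, h3, add_zero]
  -- Since `a` exceeds `b` at `v`, the edges of `β` must cover `v`, say by `{v, w}`.
  have hvv := DFunLike.congr_fun hv v
  simp only [Finsupp.add_apply] at hvv
  obtain ⟨w, hvw, hβ⟩ := exists_edge_of_vertexExp_pos e (α := β) (w := v) (by omega)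
  -- If `x_v x_w` divides `x^a`, any variable of `α` can be traded for that of `{v, w}`. Otherwise
  -- `a w = 0`, so `α` has an edge `{w, u}`, and `x_v T_{wu}` is traded for `x_u T_{vw}`.
  by_cases haw : 0 < a w
  · have hα : α ≠ 0 := by
      rintro rfl
      rw [map_zero] at hd
      have := (Finsupp.degree_eq_zero_iff β).mp hd.symm
      simp [this] at hβ
    obtain ⟨i, hi⟩ := Finsupp.ne_iff.mp hα
    refine ⟨i, _, genExp e (e.symm ⟨s(v, w), hvw⟩), genExp e i, Nat.pos_of_ne_zero hi, hβ, ?_,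
      add_comm _ _⟩
    rw [genExp_symm_mk]
    intro z
    have := hvw.ne
    simp only [Finsupp.add_apply, Finsupp.single_apply]
    split_ifs <;> subst_vars <;> first | omega | contradiction
  · have hle : genExp e (e.symm ⟨s(v, w), hvw⟩) ≤ vertexExp e β := by
      have h1 : Finsupp.single (e.symm ⟨s(v, w), hvw⟩) 1 +
          (β - Finsupp.single (e.symm ⟨s(v, w), hvw⟩) 1) = β :=
        add_tsub_cancel_of_le (Finsupp.single_le_iff.mpr hβ)
      rw [← h1, map_add, vertexExp_single]
      exact le_self_add
    have hlew := hle w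
    rw [genExp_symm_mk] at hlew
    have hvw' := DFunLike.congr_fun hv w
    simp only [Finsupp.add_apply, Finsupp.single_eq_same] at hvw' hlew
    obtain ⟨u, hwu, hα⟩ := exists_edge_of_vertexExp_pos e (α := α) (w := w) (by omega)
    refine ⟨_, _, Finsupp.single v 1, Finsupp.single u 1, hα, hβ, ?_, ?_⟩
    · rw [Finsupp.single_le_iff]
      omega
    · rw [genExp_symm_mk, genExp_symm_mk]
      abel

variable {e} in
/-- The reduction shared by both descriptions of the generators: a balanced difference of monomials
lies in an ideal `K` as soon as `K` contains the balanced differences with a common variable `T_i`,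
the multiples of the linear relations, and the multiples of the binomials of strongly primitive
walks that alternate between the two monomials. -/
theorem bimonomial_sub_mem_of_reduction
    {K : Ideal (MvPolynomial (Fin r) (MvPolynomial V k))}
    {α β : Fin r →₀ ℕ} {a b : V →₀ ℕ} (h : Balanced e α a β b)
    (hcommon : ∀ (α' : Fin r →₀ ℕ) (a' : V →₀ ℕ) (i : Fin r), Balanced e α' a' β b →
      0 < α' i → 0 < β i → bimonomial k α' a' - bimonomial k β b ∈ K)
    (hlinear : ∀ (γ : Fin r →₀ ℕ) (g c d : V →₀ ℕ) (i j : Fin r), γ + Finsupp.single i 1 = α →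
      g + c = a → genExp e i + c = genExp e j + d →
      bimonomial k γ g *
        (bimonomial k (Finsupp.single i 1) c - bimonomial k (Finsupp.single j 1) d) ∈ K)
    (hwalk : ∀ (v : V) (W : G.Walk v v) (γ : Fin r →₀ ℕ), a = b → IsStronglyPrimitive e W →
      γ + oddExp e W = α → evenExp e W ≤ β →
      bimonomial k γ a * (bimonomial k (oddExp e W) 0 - bimonomial k (evenExp e W) 0) ∈ K) :
    bimonomial k α a - bimonomial k β b ∈ K := by
  by_cases hdisj : ∀ i, α i = 0 ∨ β i = 0
  swap
  · push Not at hdisj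
    obtain ⟨i, hi, hi'⟩ := hdisj
    exact hcommon α a i h (Nat.pos_of_ne_zero hi) (Nat.pos_of_ne_zero hi')
  by_cases hab : a = b
  · by_cases hα : α = 0
    · have hβ : β = 0 := by
        have := h.2
        rw [hα, map_zero] at this
        exact (Finsupp.degree_eq_zero_iff β).mp this.symm
      rw [hα, hβ, hab, sub_self]
      exact zero_mem _
    · subst hab
      obtain ⟨u, Q, hQ, ho, hE⟩ :=
        exists_isStronglyPrimitive_le e (add_right_cancel h.1) hα hdisj
      have hα' : α - oddExp e Q + oddExp e Q = α := tsub_add_cancel_of_le ho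
      have h1 := hwalk u Q (α - oddExp e Q) rfl hQ hα' hE
      rw [mul_sub, bimonomial_mul, bimonomial_mul, hα', add_zero] at h1
      have hpos : evenExp e Q ≠ 0 := fun h0 => by
        have h2 := degree_oddExp_of_even e hQ.2.1
        have h3 := degree_oddExp_eq_degree_evenExp e hQ.2.1
        have h4 := hQ.1
        rw [h0, map_zero] at h3
        omega
      obtain ⟨i, hi⟩ := Finsupp.ne_iff.mp hpos
      have hi0 : 0 < evenExp e Q i := Nat.pos_of_ne_zero hi
      -- After the trade along `Q`, the new monomial shares with `β` every variable of an even step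
      -- of `Q`.
      have h2 := hcommon (α - oddExp e Q + evenExp e Q) a i ⟨?_, ?_⟩
        (by rw [Finsupp.add_apply]; omega) (hi0.trans_le (hE i))
      · have := add_mem h1 h2
        rwa [sub_add_sub_cancel] at this
      · rw [← h.1, map_add, ← vertexExp_oddExp_eq_evenExp e hQ.2.1, ← map_add, hα']
      · rw [← h.2, map_add, ← degree_oddExp_eq_degree_evenExp e hQ.2.1, ← map_add, hα']
  · obtain ⟨i, j, c, d, hi, hj, hca, hcd⟩ := exists_exchange e h hab
    have hα' : α - Finsupp.single i 1 + Finsupp.single i 1 = α :=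
      tsub_add_cancel_of_le (Finsupp.single_le_iff.mpr hi)
    have ha' : a - c + c = a := tsub_add_cancel_of_le hca
    have h1 := hlinear (α - Finsupp.single i 1) (a - c) c d i j hα' ha' hcd
    rw [mul_sub, bimonomial_mul, bimonomial_mul, hα', ha'] at h1
    have h2 := hcommon (α - Finsupp.single i 1 + Finsupp.single j 1) (a - c + d) j ⟨?_, ?_⟩
      (by simp) hj
    · have := add_mem h1 h2
      rwa [sub_add_sub_cancel] at this
    · rw [← h.1]
      conv_rhs => rw [← hα', ← ha']
      rw [map_add, map_add, vertexExp_single, vertexExp_single, add_add_add_comm,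
        add_add_add_comm (vertexExp e (α - Finsupp.single i 1)) (genExp e i), hcd]
    · rw [← h.2]
      conv_rhs => rw [← hα']
      simp

end Toric

/-! ### Generators of the defining ideal and minimal binomial systems -/

section Generators

variable (k : Type*) [Field k] (e : Fin r ≃ G.edgeSet)

theorem incl_walkBinomial {v w : V} (W : G.Walk v w) :
    incl V k r (walkBinomial k e W) =
      bimonomial k (evenExp e W) 0 - bimonomial k (oddExp e W) 0 := by
  simp only [incl, walkBinomial, bimonomial, map_sub, map_monomial]
  rfl

variable {k} in
theorem IsStronglyPrimitive.isBinomial_walkBinomial {e : Fin r ≃ G.edgeSet} {v : V}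
    {W : G.Walk v v} (hW : IsStronglyPrimitive e W) :
    IsBinomial (incl V k r (walkBinomial k e W)) := by
  refine ⟨evenExp e W, oddExp e W, 0, 0, fun h => ?_, Or.inl (incl_walkBinomial k e W)⟩
  exact hW.oddExp_ne_evenExp (congrArg Prod.fst h).symm

variable {e} in
theorem Balanced.of_add {α β γ : Fin r →₀ ℕ} {a b c : V →₀ ℕ}
    (h : Balanced e (γ + α) (c + a) (γ + β) (c + b)) : Balanced e α a β b := by
  obtain ⟨h1, h2⟩ := h
  rw [map_add, map_add, add_add_add_comm, add_add_add_comm (vertexExp e γ) (vertexExp e β)] at h1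
  rw [map_add, map_add] at h2
  exact ⟨add_left_cancel h1, add_left_cancel h2⟩

/-- Induction on the `T`-degree: balanced differences stay balanced after cancelling a common `T_i`,
which lowers the degree by one. -/
theorem definingIdeal_eq :
    definingIdeal k e = Ideal.span (Set.range (linearEquations (taylorMatrix k e))) ⊔
      Ideal.span {f | ∃ (v : V) (W : G.Walk v v), IsStronglyPrimitive e W ∧
        f = incl V k r (walkBinomial k e W)} := by
  apply le_antisymm
  · have key : ∀ n, ∀ (α β : Fin r →₀ ℕ) (a b : V →₀ ℕ), α.degree = n → Balanced e α a β b →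
        bimonomial k α a - bimonomial k β b ∈
          Ideal.span (Set.range (linearEquations (taylorMatrix k e))) ⊔
          Ideal.span {f | ∃ (v : V) (W : G.Walk v v), IsStronglyPrimitive e W ∧
            f = incl V k r (walkBinomial k e W)} := by
      intro n
      induction n with
      | zero =>
        intro α β a b hn h
        have hα := (Finsupp.degree_eq_zero_iff α).mp hn
        have hβ := (Finsupp.degree_eq_zero_iff β).mp (h.2 ▸ hn)
        have hab := h.1
        rw [hα, hβ, add_right_inj] at hab
        rw [hα, hβ, hab, sub_self]
        exact zero_mem _
      | succ n ih =>
        intro α β a b hn h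
        refine bimonomial_sub_mem_of_reduction k h ?_ ?_ ?_
        · intro α' a' i h' hi hi'
          have hα' : Finsupp.single i 1 + (α' - Finsupp.single i 1) = α' :=
            add_tsub_cancel_of_le (Finsupp.single_le_iff.mpr hi)
          have hβ' : Finsupp.single i 1 + (β - Finsupp.single i 1) = β :=
            add_tsub_cancel_of_le (Finsupp.single_le_iff.mpr hi')
          rw [← hα', ← hβ', ← zero_add a', ← zero_add b] at h'
          have hdeg : (α' - Finsupp.single i 1).degree = n := by
            have h1 := congrArg Finsupp.degree hβ'
            have h2 := h'.of_add.2
            rw [map_add, Finsupp.degree_single, ← h.2, hn, ← h2] at h1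
            omega
          have := Ideal.mul_mem_left _ (bimonomial k (Finsupp.single i 1) 0)
            (ih _ _ _ _ hdeg h'.of_add)
          rwa [mul_sub, bimonomial_mul, bimonomial_mul, hα', hβ', zero_add, zero_add] at this
        · intro γ g c d i j _ _ hcd
          exact Ideal.mul_mem_left _ _
            (Ideal.mem_sup_left (bimonomial_single_sub_mem k e i j c d hcd))
        · intro v W γ _ hW _ _
          refine Ideal.mul_mem_left _ _ (Ideal.mem_sup_right ?_)
          rw [← neg_sub, ← incl_walkBinomial]
          exact neg_mem (Ideal.subset_span ⟨v, W, hW, rfl⟩)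
    exact definingIdeal_le k e fun α β a b h => key _ α β a b rfl h
  · refine sup_le (Ideal.span_le.mpr ?_) (Ideal.span_le.mpr ?_)
    · rintro _ ⟨c, rfl⟩
      exact linearEquations_mem_definingIdeal k e c
    · rintro _ ⟨v, W, hW, rfl⟩
      rw [incl_walkBinomial, SetLike.mem_coe, bimonomial_sub_mem_definingIdeal_iff]
      exact ⟨by rw [vertexExp_oddExp_eq_evenExp e hW.2.1],
        (degree_oddExp_eq_degree_evenExp e hW.2.1).symm⟩

variable {k} in
/-- A binomial of `J` is a difference of two monomials with the same image. A sum of two monomials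
lies in `J` only in characteristic two. -/
theorem IsBinomial.exists_balanced {f : MvPolynomial (Fin r) (MvPolynomial V k)}
    (hf : IsBinomial f) (hfJ : f ∈ definingIdeal k e) :
    ∃ (α β : Fin r →₀ ℕ) (a b : V →₀ ℕ), (α, a) ≠ (β, b) ∧ Balanced e α a β b ∧
      f = bimonomial k α a - bimonomial k β b := by
  obtain ⟨α, β, a, b, hne, hf | hf⟩ := hf
  · refine ⟨α, β, a, b, hne, ?_, hf⟩
    rw [← bimonomial_sub_mem_definingIdeal_iff k, ← show f = bimonomial k α a - bimonomial k β b
      from hf]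
    exact hfJ
  · have hf' : f = bimonomial k α a + bimonomial k β b := hf
    have h0 := (mem_definingIdeal_iff k e f).mp hfJ
    rw [hf', map_add, AddMemClass.coe_add, coe_reesPresentation_bimonomial,
      coe_reesPresentation_bimonomial] at h0
    have hbal : Balanced e α a β b := by
      classical
      -- If the images were distinct monomials, the coefficient of the first in the image of the sum
      -- would be 1. If they agree, the image is `1 + 1` times a monomial, so `1 + 1 = 0` and the
      -- sum is a difference.
      by_contra hcon
      have h1 := congrArg (fun p => MvPolynomial.coeff (vertexExp e α + a)
        (Polynomial.coeff p α.degree)) h0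
      simp only [Polynomial.coeff_add, Polynomial.coeff_monomial, if_true, coeff_add,
        coeff_monomial, Polynomial.coeff_zero, coeff_zero] at h1
      split_ifs at h1 with h2
      · rw [coeff_monomial, if_neg, add_zero] at h1
        · exact one_ne_zero h1
        · exact fun h3 => hcon ⟨h3.symm, h2.symm⟩
      · simp at h1
    have h2 : (1 : k) + 1 = 0 := by
      rw [hbal.1, hbal.2, ← map_add, ← map_add, Polynomial.monomial_eq_zero_iff,
        monomial_eq_zero] at h0
      exact h0
    have hneg : bimonomial k β b = -bimonomial k β b := by
      rw [eq_neg_iff_add_eq_zero, bimonomial, ← map_add, ← map_add, h2, map_zero, map_zero]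
    exact ⟨α, β, a, b, hne, hbal, by rw [hf', sub_eq_add_neg, ← hneg]⟩

/-- The weight of `x^a T^α`, for which all balanced differences are homogeneous. -/
def weight (α : Fin r →₀ ℕ) (a : V →₀ ℕ) : ℕ := 2 * α.degree + a.degree

theorem weight_add (α β : Fin r →₀ ℕ) (a b : V →₀ ℕ) :
    weight (α + β) (a + b) = weight α a + weight β b := by
  simp only [weight, map_add]
  ring

theorem weight_eq_zero_iff (α : Fin r →₀ ℕ) (a : V →₀ ℕ) : weight α a = 0 ↔ α = 0 ∧ a = 0 := by
  simp [weight, Finsupp.degree_eq_zero_iff]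

variable {e} in
theorem Balanced.weight_eq {α β : Fin r →₀ ℕ} {a b : V →₀ ℕ} (h : Balanced e α a β b) :
    weight α a = weight β b := by
  have := congrArg Finsupp.degree h.1
  simpa [weight, degree_vertexExp] using this

/-- The projection of `R[T]` onto its component of weight `n`. -/
def weightComponent (V : Type*) (r : ℕ) (n : ℕ) :
    MvPolynomial (Fin r) (MvPolynomial V k) →ₗ[k] MvPolynomial (Fin r) (MvPolynomial V k) :=
  (bimonomialBasis k V r).constr k fun p =>
    if weight p.2 p.1 = n then bimonomial k p.2 p.1 else 0

theorem weightComponent_bimonomial (n : ℕ) (α : Fin r →₀ ℕ) (a : V →₀ ℕ) :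
    weightComponent k V r n (bimonomial k α a) =
      if weight α a = n then bimonomial k α a else 0 := by
  have := (bimonomialBasis k V r).constr_basis k
    (fun p => if weight p.2 p.1 = n then bimonomial k p.2 p.1 else 0) (a, α)
  rwa [bimonomialBasis_apply] at this

variable {k e} in
/-- In an irredundant system of binomial generators, a generator is not needed to express the
elements of smaller weight. -/
theorem IsMinimalBinomialSystem.mem_span_diff
    {S : Set (MvPolynomial (Fin r) (MvPolynomial V k))}
    (hS : IsMinimalBinomialSystem (definingIdeal k e) S)
    {α β : Fin r →₀ ℕ} {a b : V →₀ ℕ} (h : Balanced e α a β b)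
    {α' β' : Fin r →₀ ℕ} {a' b' : V →₀ ℕ} (h' : Balanced e α' a' β' b')
    (hlt : weight α' a' < weight α a) :
    bimonomial k α' a' - bimonomial k β' b' ∈
      Ideal.span (S \ {bimonomial k α a - bimonomial k β b}) := by
  obtain ⟨hbin, hspan, -⟩ := hS
  set f := bimonomial k α a - bimonomial k β b with hf
  set n := weight α' a' with hn
  have hdiff : ∀ (μ γ δ : Fin r →₀ ℕ) (m c d : V →₀ ℕ), Balanced e γ c δ d →
      weightComponent k V r n (bimonomial k μ m * (bimonomial k γ c - bimonomial k δ d)) =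
        if weight μ m + weight γ c = n then
          bimonomial k μ m * (bimonomial k γ c - bimonomial k δ d) else 0 := by
    intro μ γ δ m c d hbal
    rw [mul_sub, bimonomial_mul, bimonomial_mul, map_sub, weightComponent_bimonomial,
      weightComponent_bimonomial, weight_add, weight_add, ← hbal.weight_eq]
    split_ifs <;> simp
  -- By linearity `q` may be a monomial, and then `q * s` is homogeneous. Multiples of `f` are too
  -- heavy to have a component of weight `n`.
  have hgen : ∀ s ∈ S, ∀ q, weightComponent k V r n (q * s) ∈ Ideal.span (S \ {f}) := by
    intro s hs q
    have hq : q ∈ Submodule.span k (Set.range (bimonomialBasis k V r)) := by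
      rw [(bimonomialBasis k V r).span_eq]
      exact Submodule.mem_top
    induction hq using Submodule.span_induction with
    | zero => simp
    | add x y _ _ hx hy =>
      rw [add_mul, map_add]
      exact add_mem hx hy
    | smul c x _ hx =>
      rw [smul_mul_assoc, map_smul]
      exact Submodule.smul_of_tower_mem _ c hx
    | mem x hx =>
      obtain ⟨⟨m, μ⟩, rfl⟩ := hx
      rw [bimonomialBasis_apply]
      by_cases hsf : s = f
      · rw [hsf, hf, hdiff _ _ _ _ _ _ h, if_neg (by omega)]
        exact zero_mem _
      · have hsJ : s ∈ definingIdeal k e := hspan ▸ Ideal.subset_span hs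
        obtain ⟨γ, δ, c, d, -, hbal, hs'⟩ := (hbin s hs).exists_balanced e hsJ
        have hmem : bimonomial k μ m * s ∈ Ideal.span (S \ {f}) :=
          Ideal.mul_mem_left _ _ (Ideal.subset_span ⟨hs, hsf⟩)
        rw [hs'] at hmem ⊢
        rw [hdiff _ _ _ _ _ _ hbal]
        split_ifs
        · exact hmem
        · exact zero_mem _
  have hall : ∀ p ∈ Ideal.span S, ∀ q, weightComponent k V r n (q * p) ∈ Ideal.span (S \ {f}) := by
    intro p hp
    induction hp using Submodule.span_induction with
    | mem s hs => exact hgen s hs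
    | zero => simp
    | add x y _ _ hx hy =>
      intro q
      rw [mul_add, map_add]
      exact add_mem (hx q) (hy q)
    | smul c x _ hx =>
      intro q
      rw [smul_eq_mul, ← mul_assoc]
      exact hx (q * c)
  have hmem : bimonomial k α' a' - bimonomial k β' b' ∈ Ideal.span S := by
    rw [hspan, bimonomial_sub_mem_definingIdeal_iff]
    exact h'
  have := hall _ hmem 1
  rwa [one_mul, map_sub, weightComponent_bimonomial, weightComponent_bimonomial, if_pos hn.symm,
    if_pos h'.weight_eq.symm] at this

variable {k e} in
/-- In an irredundant system of binomial generators, every generator that is not linear in the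
variables `T_i` is the binomial of a strongly primitive walk. -/
theorem IsMinimalBinomialSystem.exists_isStronglyPrimitive
    {S : Set (MvPolynomial (Fin r) (MvPolynomial V k))}
    (hS : IsMinimalBinomialSystem (definingIdeal k e) S)
    {f : MvPolynomial (Fin r) (MvPolynomial V k)} (hfS : f ∈ S) (hf1 : ¬ f.IsHomogeneous 1) :
    ∃ (v : V) (W : G.Walk v v), IsStronglyPrimitive e W ∧
      f = incl V k r (walkBinomial k e W) := by
  have hfJ : f ∈ definingIdeal k e := hS.2.1 ▸ Ideal.subset_span hfS
  obtain ⟨α, β, a, b, hne, hbal, hf⟩ := (hS.1 f hfS).exists_balanced e hfJ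
  have hlower : ∀ (μ α' β' : Fin r →₀ ℕ) (m a' b' : V →₀ ℕ), Balanced e α' a' β' b' →
      weight α' a' < weight α a →
      bimonomial k μ m * (bimonomial k α' a' - bimonomial k β' b') ∈ Ideal.span (S \ {f}) := by
    intro μ α' β' m a' b' h' hlt
    rw [hf]
    exact Ideal.mul_mem_left _ _ (hS.mem_span_diff hbal h' hlt)
  -- If `f` is no walk binomial, the reduction exhibits it in the span of the other generators,
  -- contradicting irredundancy.
  by_contra hcon
  refine hS.2.2 f hfS ?_
  suffices hmem : bimonomial k α a - bimonomial k β b ∈ Ideal.span (S \ {f}) by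
    rwa [← hf] at hmem
  refine bimonomial_sub_mem_of_reduction k hbal ?_ ?_ ?_
  · intro α' a' i h' hi hi'
    have hα' : Finsupp.single i 1 + (α' - Finsupp.single i 1) = α' :=
      add_tsub_cancel_of_le (Finsupp.single_le_iff.mpr hi)
    have hβ' : Finsupp.single i 1 + (β - Finsupp.single i 1) = β :=
      add_tsub_cancel_of_le (Finsupp.single_le_iff.mpr hi')
    have hw : weight α' a' = weight α a := h'.weight_eq.trans hbal.weight_eq.symm
    rw [← hα', ← hβ', ← zero_add a', ← zero_add b] at h'
    have := hlower (Finsupp.single i 1) _ _ 0 _ _ h'.of_add (by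
      rw [← hw, ← hα', ← zero_add a', weight_add, hα', zero_add]
      simp [weight])
    rwa [mul_sub, bimonomial_mul, bimonomial_mul, hα', hβ', zero_add, zero_add] at this
  · intro γ g c d i j hγ hg hcd
    refine hlower _ _ _ _ _ _ ⟨by simpa using hcd, by simp⟩ ?_
    rw [← hγ, ← hg, weight_add]
    -- The weight drops strictly unless the cofactor is 1; in that case `α` and `β` have degree one
    -- and `f` is linear.
    refine Nat.lt_add_of_pos_left (Nat.pos_of_ne_zero fun h0 => hf1 ?_)
    have hα1 : α.degree = 1 := by
      rw [← hγ, ((weight_eq_zero_iff γ g).mp h0).1, zero_add, Finsupp.degree_single]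
    rw [hf]
    exact (isHomogeneous_monomial _ hα1).sub (isHomogeneous_monomial _ (hbal.2 ▸ hα1))
  · intro v W γ hab hW hγ hE
    have hWbal : Balanced e (oddExp e W) 0 (evenExp e W) 0 :=
      ⟨by rw [vertexExp_oddExp_eq_evenExp e hW.2.1], degree_oddExp_eq_degree_evenExp e hW.2.1⟩
    refine hlower _ _ _ _ _ _ hWbal ?_
    rw [← hγ, ← add_zero a, weight_add]
    -- With cofactor 1, `α` is the odd exponent of `W`, and comparing degrees makes `β` the even
    -- one. Hence `f` is odd minus even, the binomial of the reversed walk.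
    refine Nat.lt_add_of_pos_left (Nat.pos_of_ne_zero fun h0 => hcon ?_)
    obtain ⟨rfl, rfl⟩ := (weight_eq_zero_iff γ a).mp h0
    rw [zero_add] at hγ
    have hβ : evenExp e W = β := by
      have h1 : evenExp e W + (β - evenExp e W) = β := add_tsub_cancel_of_le hE
      have h2 := congrArg Finsupp.degree h1
      rw [map_add, ← hbal.2, ← hγ, hWbal.2] at h2
      have h3 : (β - evenExp e W).degree = 0 := by omega
      rw [Finsupp.degree_eq_zero_iff] at h3
      rw [← h1, h3, add_zero]
    refine ⟨v, W.reverse, hW.reverse, ?_⟩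
    have hrev := (oddExp_evenExp_reverse e W).1 hW.2.1
    rw [incl_walkBinomial, hrev.1, hrev.2, hγ, hβ, hf, ← hab]

end Generators

/-! ### Cyclic matrices and minors of the reduced Jacobian dual -/

section CyclicMinors

/-- A coincidence of two vertices an even number of steps apart would cut out a shorter even closed
subwalk. -/
theorem IsPrimitive.getVert_ne {v : V} {W : G.Walk v v} (hW : IsPrimitive W) {i n : ℕ}
    (hn : 0 < n) (hin : i + n ≤ W.length) (hnW : n < W.length) (hev : Even n) :
    W.getVert i ≠ W.getVert (i + n) := by
  intro h
  have hlen : ((W.drop i).take n).length = n := by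
    rw [SimpleGraph.Walk.take_length, SimpleGraph.Walk.drop_length]
    omega
  have hend : (W.drop i).getVert n = W.getVert i := by
    rw [SimpleGraph.Walk.drop_getVert, h]
  have hsub : (((W.drop i).take n).copy rfl hend).IsSubwalk W := by
    have := ((W.drop i).isSubwalk_take n).trans (W.isSubwalk_drop i)
    exact this.copy rfl hend rfl rfl
  have := hW.2.2 _ _ hsub (by rwa [SimpleGraph.Walk.length_copy, hlen])
  rw [SimpleGraph.Walk.length_copy, hlen] at this
  omega

open scoped Fin.CommRing in
/-- The permutations contributing to the determinant of a cyclic matrix. -/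
theorem eq_one_or_eq_finRotate {n : ℕ} (σ : Equiv.Perm (Fin (n + 2)))
    (h : ∀ i, σ i = i ∨ σ i = i + 1) : σ = 1 ∨ σ = finRotate (n + 2) := by
  by_cases hfix : ∃ i, σ i = i
  · left
    obtain ⟨i, hi⟩ := hfix
    -- A fixed point propagates backwards by injectivity, and going around the cycle it reaches
    -- every index.
    have hpred : ∀ j, σ (j + 1) = j + 1 → σ j = j := by
      intro j hj
      rcases h j with h' | h'
      · exact h'
      · have := σ.injective (h'.trans hj.symm)
        simp at this
    have hall : ∀ m : ℕ, ∀ j : Fin (n + 2), j + (m : Fin (n + 2)) = i → σ j = j := by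
      intro m
      induction m with
      | zero =>
        intro j hj
        simp only [Nat.cast_zero, add_zero] at hj
        rw [hj, hi]
      | succ m ih =>
        intro j hj
        refine hpred j (ih (j + 1) ?_)
        rw [← hj]
        push_cast
        ring
    ext1 j
    refine hall (i - j : Fin (n + 2)).val j ?_
    rw [Fin.cast_val_eq_self]
    ring
  · right
    push Not at hfix
    ext1 i
    rw [finRotate_apply]
    exact (h i).resolve_left (hfix i)

/-- Only the identity and the rotation avoid the zero entries in the Leibniz formula. The sign
`(-1)^(t-1)` of the rotation and the `t` minus signs of its entries combine to `-1`. -/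
theorem det_cyclicMatrix {A : Type*} [CommRing A] {t : ℕ} (ht : 2 ≤ t) (a : Fin (2 * t) → A) :
    (cyclicMatrix a).det =
      ∏ j : Fin t, a ⟨2 * j + 1, by omega⟩ - ∏ j : Fin t, a ⟨2 * j, by omega⟩ := by
  obtain ⟨n, rfl⟩ : ∃ n, t = n + 2 := ⟨t - 2, by omega⟩
  have hmod : ∀ i j : Fin (n + 2), (i : ℕ) = (j + 1) % (n + 2) ↔ i = j + 1 := by
    intro i j
    rw [Fin.ext_iff, Fin.val_add]
    simp
  have hne : ∀ j : Fin (n + 2), j + 1 ≠ j := fun j h => by simp at h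
  have hrot : (1 : Equiv.Perm (Fin (n + 2))) ≠ finRotate (n + 2) := fun h => by
    have := DFunLike.congr_fun h 0
    rw [finRotate_apply] at this
    exact hne 0 this.symm
  rw [Matrix.det_apply, Finset.sum_eq_add_of_mem 1 (finRotate (n + 2)) (Finset.mem_univ _)
    (Finset.mem_univ _) hrot, sub_eq_add_neg]
  · congr 1
    · simp [cyclicMatrix]
    · have : ∀ j : Fin (n + 2), cyclicMatrix a (finRotate (n + 2) j) j = -a ⟨2 * j, by omega⟩ := by
        intro j
        rw [cyclicMatrix, finRotate_apply, if_neg (hne j), if_pos ((hmod _ _).mpr rfl)]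
      simp only [this, sign_finRotate, Finset.prod_neg, Finset.card_univ, Fintype.card_fin]
      rw [Units.smul_def, zsmul_eq_mul, ← mul_assoc]
      push_cast
      rw [← pow_add, Odd.neg_one_pow, neg_one_mul]
      exact ⟨n + 1, by omega⟩
  · rintro σ - ⟨h1, h2⟩
    have : ∃ i, ¬ (σ i = i ∨ σ i = i + 1) := by
      by_contra! hcon
      rcases eq_one_or_eq_finRotate σ hcon with h | h
      · exact h1 h
      · exact h2 h
    obtain ⟨i, hi⟩ := this
    push Not at hi
    rw [Finset.prod_eq_zero (Finset.mem_univ i), smul_zero]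
    rw [cyclicMatrix, if_neg hi.1, if_neg fun h => hi.2 ((hmod _ _).mp h)]

variable {k : Type*} [Field k]

/-- The reduction of a Jacobian dual is determined by the linear parts of the presentation
matrix. -/
theorem IsJacobianDual.reduced_apply [Fintype V] {Γ : Type*}
    {φ : Matrix (Fin r) Γ (MvPolynomial V k)}
    {B : Matrix V Γ (MvPolynomial (Fin r) (MvPolynomial V k))} (hB : IsJacobianDual φ B)
    (v : V) (c : Γ) :
    reduced B v c = ∑ i, C (coeff (Finsupp.single v 1) (φ i c)) * X i := by
  classical
  -- Compare the coefficients of `x_v T_i` on both sides of the duality equation; on the right only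
  -- row `v` of `B` contributes, through a constant coefficient.
  have hcoeff : ∀ i, constantCoeff (coeff (Finsupp.single i 1) (B v c)) =
      coeff (Finsupp.single v 1) (φ i c) := by
    intro i
    have h1 := congrArg (fun p => coeff (Finsupp.single v 1)
      (coeff (Finsupp.single i 1) p)) (congrFun hB.2 c)
    simp only [linearEquations, Matrix.vecMul, dotProduct, Matrix.map_apply, coeff_sum,
      X_mul_C_eq_monomial, coeff_monomial, coeff_C_mul, coeff_X_mul',
      Finsupp.single_left_inj one_ne_zero] at h1
    rw [Finset.sum_eq_single i (fun j _ hj => by rw [if_neg hj, coeff_zero]) (by simp),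
      if_pos rfl, Finset.sum_eq_single v (fun w _ hw => by
        rw [if_neg (by simpa using hw)]) (by simp), if_pos (by simp)] at h1
    rw [h1]
    simp [constantCoeff_eq]
  have hhom : (reduced B v c).IsHomogeneous 1 := (hB.1 v c).map _
  ext d
  by_cases hd : ∃ i, d = Finsupp.single i 1
  · obtain ⟨i, rfl⟩ := hd
    simp [coeff_sum, coeff_C_mul, coeff_X, Finsupp.single_left_inj, reduced, coeff_map, hcoeff]
  · have hd1 : d.degree ≠ 1 := fun h => by
      have hd0 : d ≠ 0 := by
        rintro rfl
        simp at h
      obtain ⟨i, hi⟩ := Finsupp.ne_iff.mp hd0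
      have h1 : Finsupp.single i 1 + (d - Finsupp.single i 1) = d :=
        add_tsub_cancel_of_le (Finsupp.single_le_iff.mpr (Nat.one_le_iff_ne_zero.mpr hi))
      have h2 := congrArg Finsupp.degree h1
      rw [map_add, Finsupp.degree_single, h] at h2
      have h3 : (d - Finsupp.single i 1).degree = 0 := by omega
      rw [Finsupp.degree_eq_zero_iff] at h3
      exact hd ⟨i, by rw [← h1, h3, add_zero]⟩
    rw [hhom.coeff_eq_zero hd1, coeff_sum]
    refine (Finset.sum_eq_zero fun i _ => ?_).symm
    rw [coeff_C_mul, coeff_X, if_neg fun h => hd ⟨i, h.symm⟩, mul_zero]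

/-- The column of the Taylor matrix of a pair of distinct edges. -/
def pairCol (i j : Fin r) (h : i ≠ j) : TaylorCol r :=
  if hij : i < j then ⟨(i, j), hij⟩ else ⟨(j, i), lt_of_le_of_ne (not_lt.mp hij) h.symm⟩

theorem pair_eq_of_pairCol_eq {i j i' j' : Fin r} {h : i ≠ j} {h' : i' ≠ j'}
    (heq : pairCol i j h = pairCol i' j' h') : (i = i' ∧ j = j') ∨ (i = j' ∧ j = i') := by
  unfold pairCol at heq
  split_ifs at heq <;> simp only [Subtype.mk.injEq, Prod.mk.injEq] at heq <;> tauto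

theorem sup_tsub_of_path {p q w : V} (hpq : p ≠ q) (hqw : q ≠ w) (hpw : p ≠ w) :
    (Finsupp.single p 1 + Finsupp.single q 1) ⊔ (Finsupp.single q 1 + Finsupp.single w 1) -
      (Finsupp.single p 1 + Finsupp.single q 1) = (Finsupp.single w 1 : V →₀ ℕ) := by
  classical
  ext z
  simp only [Finsupp.tsub_apply, Finsupp.sup_apply, Finsupp.add_apply, Finsupp.single_apply]
  split_ifs <;> subst_vars <;> first | rfl | contradiction

/-- The lcm of the edges `pq` and `qw` is `x_p x_q x_w`, so their Taylor relation is `x_p T_j - x_w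
T_i` up to sign. The sign records which edge comes first in the enumeration. -/
theorem IsJacobianDual.reduced_pairCol [Fintype V] [DecidableEq V] {e : Fin r ≃ G.edgeSet}
    {B : Matrix V (TaylorCol r) (MvPolynomial (Fin r) (MvPolynomial V k))}
    (hB : IsJacobianDual (taylorMatrix k e) B) {i j : Fin r} (hij : i ≠ j) {p q w : V}
    (hi : genExp e i = Finsupp.single p 1 + Finsupp.single q 1)
    (hj : genExp e j = Finsupp.single q 1 + Finsupp.single w 1)
    (hpq : p ≠ q) (hqw : q ≠ w) (hpw : p ≠ w) (v : V) :
    reduced B v (pairCol i j hij) =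
      (((if i < j then 1 else -1 : ℤˣ) : ℤ) : MvPolynomial (Fin r) k) *
        ((if v = p then X j else 0) - (if v = w then X i else 0)) := by
  have h1 := sup_tsub_of_path hpq hqw hpw
  have h2 := sup_tsub_of_path hqw.symm hpq.symm hpw.symm
  rw [add_comm (Finsupp.single w 1), add_comm _ (Finsupp.single p 1)] at h2
  rw [hB.reduced_apply, Finset.sum_eq_add_of_mem i j (Finset.mem_univ _) (Finset.mem_univ _) hij]
  · by_cases hlt : i < j
    · have hti : taylorMatrix k e i (pairCol i j hij) = -monomial (Finsupp.single w 1) 1 := by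
        simp only [pairCol, hlt, dif_pos, taylorMatrix, if_true]
        rw [hi, hj, h1]
      have htj : taylorMatrix k e j (pairCol i j hij) = monomial (Finsupp.single p 1) 1 := by
        simp only [pairCol, hlt, dif_pos, taylorMatrix, if_true, if_neg hij.symm]
        rw [hi, hj, sup_comm, h2]
      rw [hti, htj, if_pos hlt, coeff_neg, coeff_monomial, coeff_monomial]
      simp only [Finsupp.single_left_inj one_ne_zero, eq_comm (b := v)]
      split_ifs <;> simp [neg_add_eq_sub]
    · have hti : taylorMatrix k e i (pairCol i j hij) = monomial (Finsupp.single w 1) 1 := by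
        simp only [pairCol, hlt, dif_neg, not_false_eq_true, taylorMatrix, if_true, if_neg hij]
        rw [hi, hj, sup_comm, h1]
      have htj : taylorMatrix k e j (pairCol i j hij) = -monomial (Finsupp.single p 1) 1 := by
        simp only [pairCol, hlt, dif_neg, not_false_eq_true, taylorMatrix, if_true]
        rw [hi, hj, h2]
      rw [hti, htj, if_neg hlt, coeff_neg, coeff_monomial, coeff_monomial]
      simp only [Finsupp.single_left_inj one_ne_zero, eq_comm (b := v)]
      split_ifs <;> simp [sub_eq_add_neg]
  · rintro l - ⟨hl, hl'⟩
    have : taylorMatrix k e l (pairCol i j hij) = 0 := by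
      unfold pairCol
      split_ifs <;> simp [taylorMatrix, hl, hl']
    rw [this, coeff_zero, map_zero, zero_mul]

theorem genExp_edgeIdx (e : Fin r ≃ G.edgeSet) {v w : V} (W : G.Walk v w) (i : Fin W.length) :
    genExp e (edgeIdx e W i) =
      Finsupp.single (W.getVert i) 1 + Finsupp.single (W.getVert (i + 1)) 1 :=
  genExp_symm_mk e _

theorem walkBinomial_eq_prod_sub_prod (e : Fin r ≃ G.edgeSet) {v w : V} (W : G.Walk v w) {t : ℕ}
    (ht : W.length = 2 * t) :
    walkBinomial k e W = ∏ j : Fin t, X (edgeIdx e W ⟨2 * j + 1, by omega⟩) -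
      ∏ j : Fin t, X (edgeIdx e W ⟨2 * j, by omega⟩) := by
  rw [walkBinomial, evenExp, oddExp, monomial_sum_one, monomial_sum_one]
  congr 1
  · symm
    refine Finset.prod_bij (fun (j : Fin t) _ => (⟨2 * j + 1, by omega⟩ : Fin W.length))
      (fun j _ => by simp) (fun j _ l _ h => ?_) (fun i hi => ?_) (fun j _ => rfl)
    · simp only [Fin.mk.injEq] at h
      exact Fin.ext (by omega)
    · obtain ⟨m, hm⟩ := (Finset.mem_filter.mp hi).2
      exact ⟨⟨m, by omega⟩, Finset.mem_univ _, Fin.ext hm.symm⟩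
  · symm
    refine Finset.prod_bij (fun (j : Fin t) _ => (⟨2 * j, by omega⟩ : Fin W.length))
      (fun j _ => by simp) (fun j _ l _ h => ?_) (fun i hi => ?_) (fun j _ => rfl)
    · simp only [Fin.mk.injEq] at h
      exact Fin.ext (by omega)
    · obtain ⟨m, hm⟩ := (Finset.mem_filter.mp hi).2
      exact ⟨⟨m, by omega⟩, Finset.mem_univ _, Fin.ext (by simp only; omega)⟩

/-- A square matrix which is cyclic up to the signs of its columns becomes a matrix with the
determinant of the cyclic matrix after at most one interchange of two rows. -/
theorem exists_perm_isCyclicForm {A : Type*} [CommRing A] {t : ℕ} (ht : 2 ≤ t)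
    (N : Matrix (Fin t) (Fin t) A) (a : Fin (2 * t) → A) (ε : Fin t → ℤˣ)
    (hN : ∀ i j, N i j = ((ε j : ℤ) : A) * cyclicMatrix a i j) :
    ∃ σ : Equiv.Perm (Fin t), IsCyclicForm (N.submatrix σ id) a ∧
      (N.submatrix σ id).det = (cyclicMatrix a).det := by
  have hdet : N.det = (((∏ j, ε j : ℤˣ) : ℤ) : A) * (cyclicMatrix a).det := by
    have h1 : N = Matrix.of fun i j => ((ε j : ℤ) : A) * cyclicMatrix a i j := by
      ext i j
      exact hN i j
    rw [h1, Matrix.det_mul_row]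
    push_cast
    rfl
  rcases Int.units_eq_one_or (∏ j, ε j) with hε | hε
  · refine ⟨1, ⟨1, 1, ε, fun i j => hN i j⟩, ?_⟩
    change N.det = _
    rw [hdet, hε]
    simp
  · have h01 : (⟨0, by omega⟩ : Fin t) ≠ ⟨1, by omega⟩ := by simp
    -- Interchanging two rows absorbs a total column sign of `-1`; the row permutation in the cyclic
    -- form undoes the interchange.
    refine ⟨Equiv.swap ⟨0, by omega⟩ ⟨1, by omega⟩,
      ⟨Equiv.swap ⟨0, by omega⟩ ⟨1, by omega⟩, 1, ε, fun i j => ?_⟩, ?_⟩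
    · simpa using hN i j
    · rw [Matrix.det_permute, hdet, hε, Equiv.Perm.sign_swap h01]
      simp

/-- The rows are the vertices in even position; column `j` is the Taylor relation of the steps `2j`
and `2j + 1`, whose outer ends are the rows `j` and `j + 1` modulo `t`. -/
theorem IsPrimitive.isCyclicMinor [Fintype V] {e : Fin r ≃ G.edgeSet}
    {B : Matrix V (TaylorCol r) (MvPolynomial (Fin r) (MvPolynomial V k))}
    (hB : IsJacobianDual (taylorMatrix k e) B) {v : V} {W : G.Walk v v} (hW : IsPrimitive W) :
    IsCyclicMinor e (reduced B) W := by
  classical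
  obtain ⟨t, ht⟩ : ∃ t, W.length = 2 * t := hW.2.1.two_dvd
  have ht2 : 2 ≤ t := by
    have := hW.1
    omega
  have hadj : ∀ n < 2 * t, W.getVert n ≠ W.getVert (n + 1) := fun n hn =>
    (W.adj_getVert_succ (by omega)).ne
  have hinj : ∀ m n, m < n → n < m + 2 * t → n ≤ 2 * t → Even (n - m) →
      W.getVert m ≠ W.getVert n := by
    intro m n hmn hn hn' hev
    have := hW.getVert_ne (i := m) (n := n - m) (by omega) (by omega) (by omega) hev
    rwa [Nat.add_sub_cancel' hmn.le] at this
  have hrows : ∀ i j : Fin t, W.getVert (2 * i) = W.getVert (2 * j) → i = j := by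
    intro i j h
    rcases lt_trichotomy i j with hij | hij | hij
    · exact absurd h (hinj _ _ (by omega) (by omega) (by omega) ⟨j - i, by omega⟩)
    · exact hij
    · exact absurd h.symm (hinj _ _ (by omega) (by omega) (by omega) ⟨i - j, by omega⟩)
  have hodd : ∀ i j : Fin t, W.getVert (2 * i + 1) = W.getVert (2 * j + 1) → i = j := by
    intro i j h
    rcases lt_trichotomy i j with hij | hij | hij
    · exact absurd h (hinj _ _ (by omega) (by omega) (by omega) ⟨j - i, by omega⟩)
    · exact hij
    · exact absurd h.symm (hinj _ _ (by omega) (by omega) (by omega) ⟨i - j, by omega⟩)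
  have hends : ∀ j : Fin t, W.getVert (2 * j) ≠ W.getVert (2 * j + 1 + 1) := fun j =>
    hinj _ _ (by omega) (by omega) (by omega) ⟨1, by omega⟩
  let p : Fin t → Fin r := fun j => edgeIdx e W ⟨2 * j, by omega⟩
  let q : Fin t → Fin r := fun j => edgeIdx e W ⟨2 * j + 1, by omega⟩
  have hp : ∀ j, genExp e (p j) = Finsupp.single (W.getVert (2 * j)) 1 +
      Finsupp.single (W.getVert (2 * j + 1)) 1 := fun j => genExp_edgeIdx e W _
  have hq : ∀ j, genExp e (q j) = Finsupp.single (W.getVert (2 * j + 1)) 1 +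
      Finsupp.single (W.getVert (2 * j + 1 + 1)) 1 := fun j => genExp_edgeIdx e W _
  have hpq : ∀ j, p j ≠ q j := by
    intro j h
    have h1 := hp j
    rw [h, hq j, add_comm, add_right_cancel_iff, Finsupp.single_left_inj one_ne_zero] at h1
    exact hends j h1.symm
  let cols : Fin t → TaylorCol r := fun j => pairCol (p j) (q j) (hpq j)
  have hcols : cols.Injective := by
    intro j l hjl
    have hsum : genExp e (p j) + genExp e (q j) = genExp e (p l) + genExp e (q l) := by
      rcases pair_eq_of_pairCol_eq hjl with ⟨h1, h2⟩ | ⟨h1, h2⟩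
      · rw [h1, h2]
      · rw [h1, h2, add_comm]
    rw [hp, hq, hp, hq] at hsum
    refine hodd j l ?_
    -- At the middle vertex of pair `j` the left side is at least 2. If the middle vertices differ,
    -- the right side is at most 1, because the outer ends of pair `l` are distinct.
    by_contra hne
    have h1 := DFunLike.congr_fun hsum (W.getVert (2 * j + 1))
    simp only [Finsupp.add_apply, Finsupp.single_eq_same, Finsupp.single_apply] at h1
    rw [if_neg (Ne.symm hne)] at h1
    have h2 := hends l
    split_ifs at h1 with h3 h4 h5 h6 h7 <;> first | omega | exact h2 (by simp_all)
  -- Closedness of `W` returns the last column to row 0, which gives the corner entry.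
  have hnext : ∀ j : Fin t, W.getVert (2 * j + 1 + 1) = W.getVert (2 * ((j + 1) % t)) := by
    intro j
    by_cases hj : (j : ℕ) + 1 < t
    · rw [Nat.mod_eq_of_lt hj]
      rfl
    · have hjt : (j : ℕ) + 1 = t := by omega
      have h2 : 2 * (j : ℕ) + 1 + 1 = W.length := by omega
      rw [hjt, Nat.mod_self, h2, SimpleGraph.Walk.getVert_length, Nat.mul_zero,
        SimpleGraph.Walk.getVert_zero]
  have hmod : ∀ j : Fin t, ((j : ℕ) + 1) % t ≠ j := by
    intro j
    by_cases hj : (j : ℕ) + 1 < t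
    · rw [Nat.mod_eq_of_lt hj]
      omega
    · have hjt : (j : ℕ) + 1 = t := by omega
      rw [hjt, Nat.mod_self]
      omega
  let a : Fin (2 * t) → MvPolynomial (Fin r) k := fun i => X (edgeIdx e W (Fin.cast ht.symm i))
  have hentry : ∀ i j : Fin t,
      ((reduced B).submatrix (fun i : Fin t => W.getVert (2 * i)) cols) i j =
        (((if p j < q j then 1 else -1 : ℤˣ) : ℤ) : MvPolynomial (Fin r) k) *
          cyclicMatrix a i j := by
    intro i j
    rw [Matrix.submatrix_apply, hB.reduced_pairCol (hpq j) (hp j) (hq j) (hadj _ (by omega))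
      (hadj _ (by omega)) (hends j)]
    congr 1
    rw [hnext j]
    have h1 : (W.getVert (2 * i) = W.getVert (2 * j)) ↔ i = j :=
      ⟨hrows i j, fun h => by rw [h]⟩
    have h2 : (W.getVert (2 * i) = W.getVert (2 * ((j + 1) % t))) ↔ (i : ℕ) = (j + 1) % t :=
      ⟨fun h => congrArg Fin.val (hrows i ⟨(j + 1) % t, Nat.mod_lt _ (by omega)⟩ h),
        fun h => by rw [h]⟩
    simp only [h1, h2, cyclicMatrix]
    by_cases hij : i = j
    · rw [if_pos hij, if_pos hij, if_neg (by rw [hij]; exact (hmod j).symm), sub_zero]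
      rfl
    · rw [if_neg hij, if_neg hij, zero_sub]
      split_ifs
      · rfl
      · exact neg_zero
  obtain ⟨σ, hform, hdet⟩ := exists_perm_isCyclicForm ht2 _ a _ hentry
  refine ⟨t, ht, fun i => W.getVert (2 * σ i), cols, ?_, hcols, hform, ?_⟩
  · intro i j h
    exact σ.injective (hrows _ _ h)
  · rw [walkBinomial_eq_prod_sub_prod e W ht]
    exact hdet.trans (det_cyclicMatrix ht2 a)

end CyclicMinors

end

end EdgeRees

theorem mainTheorem3 {k : Type*} [Field k] {V : Type*} [Fintype V]
    (G : SimpleGraph V) {r : ℕ} (e : Fin r ≃ G.edgeSet)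
    (B : Matrix V (EdgeRees.TaylorCol r) (MvPolynomial (Fin r) (MvPolynomial V k)))
    (hB : EdgeRees.IsJacobianDual (EdgeRees.taylorMatrix k e) B) :
    -- every nonlinear generator comes from a primitive even closed walk and is a cyclic minor
    (∀ S : Set (MvPolynomial (Fin r) (MvPolynomial V k)),
      EdgeRees.IsMinimalBinomialSystem (EdgeRees.definingIdeal k e) S →
      ∀ f ∈ S, ¬ f.IsHomogeneous 1 →
        ∃ (v : V) (W : G.Walk v v),
          EdgeRees.IsPrimitive W ∧ EdgeRees.IsStronglyPrimitive e W ∧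
          f = EdgeRees.incl V k r (EdgeRees.walkBinomial k e W) ∧
          EdgeRees.IsCyclicMinor e (EdgeRees.reduced B) W) ∧
    -- the linear equations and the binomials of the primitive even closed walks generate `J`
    EdgeRees.definingIdeal k e =
      Ideal.span (Set.range (EdgeRees.linearEquations (EdgeRees.taylorMatrix k e))) ⊔
      Ideal.span {f | ∃ (v : V) (W : G.Walk v v), EdgeRees.IsStronglyPrimitive e W ∧
        f = EdgeRees.incl V k r (EdgeRees.walkBinomial k e W)} ∧
    -- the binomial of every primitive even closed walk is a cyclic minor
    (∀ (v : V) (W : G.Walk v v), EdgeRees.IsPrimitive W →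
      EdgeRees.IsCyclicMinor e (EdgeRees.reduced B) W) ∧
    (∀ (v : V) (W : G.Walk v v), EdgeRees.IsStronglyPrimitive e W →
      EdgeRees.IsPrimitive W ∧
      EdgeRees.IsBinomial (EdgeRees.incl V k r (EdgeRees.walkBinomial k e W))) := by
  refine ⟨fun S hS f hfS hf1 => ?_, EdgeRees.definingIdeal_eq k e,
    fun v W hW => hW.isCyclicMinor hB,
    fun v W hW => ⟨hW.isPrimitive, hW.isBinomial_walkBinomial⟩⟩
  obtain ⟨v, W, hW, hf⟩ := hS.exists_isStronglyPrimitive hfS hf1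
  exact ⟨v, W, hW.isPrimitive, hW, hf, hW.isPrimitive.isCyclicMinor hB⟩
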